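/- **Setting.** Let $\mathcal N$ be a connected network without loops in $\mathbb R^n$: finitely many distinct vertices $x_i$ $(i\in\mathcal I)$ and edges $e_j$ $(j\in\mathcal J)$, where $\bar e_j=\pi_j([0,\ell_j])$ for a $C^1$ diffeomorphism $\pi_j$ of $[0,\ell_j]$ onto its image, the endpoints of $\bar e_j$ are vertices, and the open edges $e_j=\pi_j((0,\ell_j))$ are pairwise disjoint and contain no vertex. Let $\mathrm{Inc}_i$ be the set of indices of the edges with endpoint $x_i$. A nonempty set $\mathcal I_B\subset\mathcal I$ of boundary indices is given, containing every $i$ with $\#\mathrm{Inc}_i=1$; $\partial\mathcal N=\{x_i\}_{i\in\mathcal I_B}$ and $\mathcal I_T=\mathcal I\setminus\mathcal I_B$. Write $u_j=u\circ\pi_j$; $C(\mathcal N)$, $C^1(\mathcal N)$ are the functions on $\mathcal N$ that are continuous, respectively $C^1$, on every closed edge (and single-valued at vertices), $W^{1,\infty}(\mathcal N)=\prod_jW^{1,\infty}(0,\ell_j)$. For $j\in \mathrm{Inc}_i$, $D_ju(x_i)$ is the one-sided derivative of $u_j$ at $x_i$ in the direction pointing into $e_j$; when it exists and is nonzero, $\sigma_{ij}(u)$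 is its sign, and $\mathrm{Inc}_i^\pm(u)=\{j\in\mathrm{Inc}_i:\sigma_{ij}(u)=\pm1\}$. **Data.** $\eta_j\in C([0,\ell_j])$ with $\eta_j>0$; $f\in L^\infty(\mathcal N)$, $f\ge0$, with essential support $\mathrm{supp}(f)$ of positive measure; for every $i\in\mathcal I_T$ and every nonempty $A\subset\mathrm{Inc}_i$, positive coefficients $(C_{ij})_{j\in A}$, depending on $A$, with $\sum_{j\in A}C_{ij}=1$. **Distance.** $\mathcal D(x,y)$ is the infimum over paths along $\mathcal N$ from $x$ to $y$ of the length weighted by $1/\eta$ (in the parameters), $d(x)=\min_{y\in\partial\mathcal N}\mathcal D(x,y)$, and $u^f(x)=\max_{y\in\mathrm{supp}(f)}[d(y)-\mathcal D(x,y)]_+$. Let $S_j(d)\subset(0,\ell_j)$ be the set of points where $d_j$ is not differentiable, $T_j(d)=\{\pi_j^{-1}(x_i): j\in\mathrm{Inc}_i^-(d)\}$, $\Sigma_j(d)=S_j(d)\cup T_j(d)$, and let $S(d)$ be the union of the sets $\pi_j(S_j(d))$ and of the set of vertices at which $d$ has a local maximum. With $d_j'$ one-sided at $0,\ell_j$,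 set $\tau_j(t)=\min\{s\ge0: t+s\,\eta_j(t)d_j'(t)\in\Sigma_j(d)\}$ and $P_j(t)=t+\tau_j(t)\eta_j(t)d_j'(t)$. **Solutions.** A pair $(u,v)$, $v=(v_j)_j$, is a solution of the sandpiles problem if 1. $v_j\in C([0,\ell_j])$ and $v_j\ge0$ for all $j$; 2. $u\in(W^{1,\infty}\cap C)(\mathcal N)$, $u\ge0$, $\eta|Du|\le1$ a.e., and $u$ is a viscosity solution of $|Du|-1/\eta=0$ at the points $x\in\mathcal N\setminus\partial\mathcal N$ with $v(x)\neq0$ (at a vertex: $v_j\ne0$ for some incident $j$). With test functions $\varphi\in C^1(\mathcal N)$ this means: at points of $e_j$, $|D_j\varphi|\le 1/\eta_j$ (resp. $\ge$) where $u-\varphi$ has a local maximum (resp. minimum), and, at such vertices $x_i$, $\max_{j\in\mathrm{Inc}_i}\{|D_j\varphi(x_i)|-1/\eta_j(x_i)\}\ge0$ if $u-\varphi$ has a local minimum; 3. $\int_{\mathcal N}v\,\eta\,Du\,D\psi=\int_{\mathcal N}f\psi$ for all $\psi\in(W^{1,\infty}\cap C)(\mathcal N)$ with $\psi=0$ on $\partial\mathcal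 N$; 4. $u=0$ on $\partial\mathcal N$, and for all $i\in\mathcal I_T$, $j\in\mathrm{Inc}_i$: $v_j(x_i)=0$ if $\sigma_{ij}(u)$ is not defined, and $v_j(x_i)=C_{ij}\sum_{k\in\mathrm{Inc}_i^+(u)}v_k(x_i)$ if $j\in\mathrm{Inc}_i^-(u)$, with the coefficients associated with $A=\mathrm{Inc}_i^-(u)$. **Theorem.** There is exactly one family $v^f=(v^f_j)_{j}$ of functions on the intervals $[0,\ell_j]$ such that, for all $j\in\mathcal J$ and $t\in[0,\ell_j]$, $$v^f_j(t)=\int_0^{\tau_j(t)}f_j\big(t+r\,\eta_j(t)d_j'(t)\big)\,dr+\Big(C_{ij}\sum_{k\in\mathrm{Inc}_i^+(d)}v^f_k(\pi_k^{-1}(x_i))\Big)\chi_{T_j(d)}(P_j(t)),\qquad x_i=\pi_j(P_j(t)),$$ with the coefficients associated with $A=\mathrm{Inc}_i^-(d)$. If $(u,v)$ is a solution of the sandpiles problem, then $u=d=u^f$ on $\mathrm{supp}(v^f)=\bigcup_j\pi_j(\mathrm{supp}(v_j^f))$ and $v=v^f$ on every closed edge. If moreover $S(d)\subset\mathrm{supp}(f)$,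 then $u=d$ on all of $\mathcal N$ and $v=v^f$ on every closed edge. -/

import Mathlib

open Set Filter Topology MeasureTheory
open scoped ContDiff

noncomputable section

/-- A network in `ℝⁿ` with `nV` vertices and `nE` edges. The `j`-th closed edge is the curve
`param j` on `[0, len j]`; injectivity on the closed interval excludes self-intersections
and loops, and distinct edges meet at vertices only. -/
structure Network (n nV nE : ℕ) where
  pos : Fin nV → EuclideanSpace ℝ (Fin n)
  pos_injective : Function.Injective pos
  len : Fin nE → ℝ
  len_pos : ∀ j, 0 < len j
  param : Fin nE → ℝ → EuclideanSpace ℝ (Fin n)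
  src : Fin nE → Fin nV
  tgt : Fin nE → Fin nV
  param_zero : ∀ j, param j 0 = pos (src j)
  param_len : ∀ j, param j (len j) = pos (tgt j)
  contDiffOn_param : ∀ j, ContDiffOn ℝ 1 (param j) (Icc 0 (len j))
  derivWithin_param_ne_zero :
    ∀ j, ∀ t ∈ Icc 0 (len j), derivWithin (param j) (Icc 0 (len j)) t ≠ 0
  injOn_param : ∀ j, InjOn (param j) (Icc 0 (len j))
  edge_disjoint_vertices : ∀ j, ∀ t ∈ Ioo 0 (len j), ∀ i, param j t ≠ pos i
  edges_disjoint : ∀ j k, j ≠ k →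
    Disjoint (param j '' Ioo 0 (len j)) (param k '' Ioo 0 (len k))
  connected : ∀ i k, Relation.ReflTransGen
    (fun a b => ∃ j, (src j = a ∧ tgt j = b) ∨ (src j = b ∧ tgt j = a)) i k
  /-- the indices of the boundary vertices -/
  boundary : Finset (Fin nV)
  boundary_nonempty : boundary.Nonempty
  mem_boundary_of_degree_one :
    ∀ i, (Finset.univ.filter fun j => src j = i ∨ tgt j = i).card = 1 → i ∈ boundary

namespace Network

variable {n nV nE : ℕ} (N : Network n nV nE)

/-- The set of all points of the network. -/
def carrier : Set (EuclideanSpace ℝ (Fin n)) :=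
  range N.pos ∪ ⋃ j, N.param j '' Icc 0 (N.len j)

/-- The indices of the edges having an endpoint at the `i`-th vertex. -/
def Inc (i : Fin nV) : Finset (Fin nE) :=
  Finset.univ.filter fun j => N.src j = i ∨ N.tgt j = i

/-- For `j ∈ Inc i`, the parameter in `{0, len j}` of the `i`-th vertex on the `j`-th edge. -/
def endParam (i : Fin nV) (j : Fin nE) : ℝ := if N.src j = i then 0 else N.len j

/-- For `j ∈ Inc i`, the parameter at parameter-distance `h` from the `i`-th vertex
on the `j`-th edge. -/
def inward (i : Fin nV) (j : Fin nE) (h : ℝ) : ℝ := if N.src j = i then h else N.len j - h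

/-! ### Function spaces -/

/-- The projection of a function on the network to the parameters of the `j`-th edge. -/
def proj (u : EuclideanSpace ℝ (Fin n) → ℝ) (j : Fin nE) (t : ℝ) : ℝ := u (N.param j t)

/-- `u ∈ C(𝒩)`; since `u` is a function of points, its edge values agree at vertices. -/
def IsContinuous (u : EuclideanSpace ℝ (Fin n) → ℝ) : Prop :=
  ∀ j, ContinuousOn (N.proj u j) (Icc 0 (N.len j))

/-- `φ ∈ C¹(𝒩)`. -/
def IsC1 (φ : EuclideanSpace ℝ (Fin n) → ℝ) : Prop :=
  N.IsContinuous φ ∧ ∀ j, ContDiffOn ℝ 1 (N.proj φ j) (Icc 0 (N.len j))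

/-- `w ∈ W^{1,∞}(0, l)` with weak derivative `g`. -/
def HasSobolevDeriv (l : ℝ) (w g : ℝ → ℝ) : Prop :=
  MemLp w ⊤ (volume.restrict (Ioo 0 l)) ∧ MemLp g ⊤ (volume.restrict (Ioo 0 l)) ∧
    ∀ φ : ℝ → ℝ, ContDiff ℝ ∞ φ → HasCompactSupport φ → tsupport φ ⊆ Ioo 0 l →
      ∫ t in Ioo 0 l, w t * deriv φ t = -∫ t in Ioo 0 l, g t * φ t

/-- `u ∈ (W^{1,∞} ∩ C)(𝒩)` with weak derivative `Du` on the edges. -/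
def HasDu (u : EuclideanSpace ℝ (Fin n) → ℝ) (Du : Fin nE → ℝ → ℝ) : Prop :=
  N.IsContinuous u ∧ ∀ j, HasSobolevDeriv (N.len j) (N.proj u j) (Du j)

/-- `a` is the internal oriented derivative `D_j u(x_i)`, for `j ∈ Inc i`. -/
def HasInnerDeriv (u : EuclideanSpace ℝ (Fin n) → ℝ) (i : Fin nV) (j : Fin nE) (a : ℝ) : Prop :=
  Tendsto (fun h => (N.proj u j (N.inward i j h) - N.proj u j (N.endParam i j)) / h)
    (𝓝[>] 0) (𝓝 a)

/-- The slope `σ_{ij}(u)` is defined. -/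
def SlopeDefined (u : EuclideanSpace ℝ (Fin n) → ℝ) (i : Fin nV) (j : Fin nE) : Prop :=
  ∃ a, a ≠ 0 ∧ N.HasInnerDeriv u i j a

open Classical in
/-- `Inc_i^+(u)`: the incident edges along which `u` leaves `x_i` uphill. -/
def IncPlus (u : EuclideanSpace ℝ (Fin n) → ℝ) (i : Fin nV) : Finset (Fin nE) :=
  (N.Inc i).filter fun j => ∃ a, 0 < a ∧ N.HasInnerDeriv u i j a

open Classical in
/-- `Inc_i^-(u)`: the incident edges along which `u` leaves `x_i` downhill. -/
def IncMinus (u : EuclideanSpace ℝ (Fin n) → ℝ) (i : Fin nV) : Finset (Fin nE) :=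
  (N.Inc i).filter fun j => ∃ a, a < 0 ∧ N.HasInnerDeriv u i j a

/-! ### The data -/

/-- The admissible capacities `η`. -/
def IsCapacity (η : Fin nE → ℝ → ℝ) : Prop :=
  ∀ j, ContinuousOn (η j) (Icc 0 (N.len j)) ∧ ∀ t ∈ Icc 0 (N.len j), 0 < η j t

/-- The essential support, in `[0, l]`, of a function on `(0, l)`. -/
def essSupport (l : ℝ) (g : ℝ → ℝ) : Set ℝ :=
  {t ∈ Icc 0 l | ∀ U ∈ 𝓝 t, 0 < volume (U ∩ {s ∈ Ioo 0 l | g s ≠ 0})}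

/-- The admissible sources `f`. -/
def IsSource (f : Fin nE → ℝ → ℝ) : Prop :=
  (∀ j, MemLp (f j) ⊤ (volume.restrict (Ioo 0 (N.len j)))) ∧
  (∀ j, ∀ᵐ t ∂(volume.restrict (Ioo 0 (N.len j))), 0 ≤ f j t) ∧
  ∃ j, 0 < volume (essSupport (N.len j) (f j))

/-- `supp(f)` as a set of points of the network. -/
def sourceSupport (f : Fin nE → ℝ → ℝ) : Set (EuclideanSpace ℝ (Fin n)) :=
  ⋃ j, N.param j '' essSupport (N.len j) (f j)

/-- Distribution coefficients: `C i A j` is the coefficient `C_{ij}` associated with the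
subset `A` of `Inc i` at the transition vertex `i`. -/
def IsDistribution (C : Fin nV → Finset (Fin nE) → Fin nE → ℝ) : Prop :=
  ∀ i, i ∉ N.boundary → ∀ A : Finset (Fin nE), A ⊆ N.Inc i → A.Nonempty →
    (∀ j ∈ A, 0 < C i A j) ∧ ∑ j ∈ A, C i A j = 1

/-! ### The weighted distance and its singular set -/

/-- The weighted length of the sub-edge with end parameters `s`, `t` of the `j`-th edge. -/
def subEdgeLength (η : Fin nE → ℝ → ℝ) (j : Fin nE) (s t : ℝ) : ℝ :=
  |∫ r in s..t, 1 / η j r|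

/-- `L` is the weighted length of a path from `x` to `y` along the network: a single sub-edge, or
a sub-edge from `x` to a vertex followed by a path from that vertex. -/
inductive IsPathLength (η : Fin nE → ℝ → ℝ) :
    EuclideanSpace ℝ (Fin n) → EuclideanSpace ℝ (Fin n) → ℝ → Prop
  | single (j : Fin nE) (s t : ℝ) (hs : s ∈ Icc 0 (N.len j)) (ht : t ∈ Icc 0 (N.len j)) :
      IsPathLength η (N.param j s) (N.param j t) (subEdgeLength η j s t)
  | cons (j : Fin nE) (s : ℝ) (hs : s ∈ Icc 0 (N.len j)) (i : Fin nV) (hi : j ∈ N.Inc i)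
      (y : EuclideanSpace ℝ (Fin n)) (L : ℝ) (hL : IsPathLength η (N.pos i) y L) :
      IsPathLength η (N.param j s) y (subEdgeLength η j s (N.endParam i j) + L)

/-- The weighted distance `𝒟(x, y)`. -/
def wdist (η : Fin nE → ℝ → ℝ) (x y : EuclideanSpace ℝ (Fin n)) : ℝ :=
  sInf {L | N.IsPathLength η x y L}

/-- The weighted distance `d` from the boundary of the network. -/
def bdist (η : Fin nE → ℝ → ℝ) (x : EuclideanSpace ℝ (Fin n)) : ℝ :=
  N.boundary.inf' N.boundary_nonempty fun i => N.wdist η x (N.pos i)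

/-- `S_j(u)`: the parameters in `(0, len j)` at which `u_j` is not differentiable. -/
def singParams (u : EuclideanSpace ℝ (Fin n) → ℝ) (j : Fin nE) : Set ℝ :=
  {t ∈ Ioo 0 (N.len j) | ¬ DifferentiableAt ℝ (N.proj u j) t}

/-- The singular set `S(d)`. -/
def singularSet (η : Fin nE → ℝ → ℝ) : Set (EuclideanSpace ℝ (Fin n)) :=
  (⋃ j, N.param j '' N.singParams (N.bdist η) j) ∪
    {x | ∃ i, x = N.pos i ∧ IsLocalMaxOn (N.bdist η) N.carrier x}

/-- `T_j(d)`: the end parameters of the `j`-th edge from which `d` goes downhill. -/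
def lowParams (η : Fin nE → ℝ → ℝ) (j : Fin nE) : Set ℝ :=
  {t | ∃ i, j ∈ N.IncMinus (N.bdist η) i ∧ t = N.endParam i j}

/-- The projection set `Σ_j(d) = S_j(d) ∪ T_j(d)`. -/
def projSet (η : Fin nE → ℝ → ℝ) (j : Fin nE) : Set ℝ :=
  N.singParams (N.bdist η) j ∪ N.lowParams η j

/-- The direction `η_j(t) d_j'(t)`; the derivative is one-sided at the ends of `[0, len j]`. -/
def dirn (η : Fin nE → ℝ → ℝ) (j : Fin nE) (t : ℝ) : ℝ :=
  η j t * derivWithin (N.proj (N.bdist η) j) (Icc 0 (N.len j)) t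

/-- `τ_j(t)`. -/
def tau (η : Fin nE → ℝ → ℝ) (j : Fin nE) (t : ℝ) : ℝ :=
  sInf {s | 0 ≤ s ∧ t + s * N.dirn η j t ∈ N.projSet η j}

/-- The projection `P_j(t)` onto `Σ_j(d)`. -/
def projParam (η : Fin nE → ℝ → ℝ) (j : Fin nE) (t : ℝ) : ℝ := t + N.tau η j t * N.dirn η j t

open Classical in
/-- `w = v^f`: on every closed edge, `w` satisfies the representation formula
`w_j(t) = ∫_0^{τ_j(t)} f_j(t + r η_j(t) d_j'(t)) dr
  + (C_{ij} ∑_{k ∈ Inc_i^+(d)} w_k(x_i)) χ_{T_j(d)}(P_j(t))` with `x_i = π_j(P_j(t))`.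
The sum over `i` has at most one term, and has one exactly when `P_j(t) ∈ T_j(d)`. -/
def IsRollingFormula (η f : Fin nE → ℝ → ℝ) (C : Fin nV → Finset (Fin nE) → Fin nE → ℝ)
    (w : Fin nE → ℝ → ℝ) : Prop :=
  ∀ j, ∀ t ∈ Icc 0 (N.len j),
    w j t = (∫ r in (0 : ℝ)..N.tau η j t, f j (t + r * N.dirn η j t)) +
      ∑ i ∈ Finset.univ.filter
          (fun i => j ∈ N.IncMinus (N.bdist η) i ∧ N.projParam η j t = N.endParam i j),
        C i (N.IncMinus (N.bdist η) i) j *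
          ∑ k ∈ N.IncPlus (N.bdist η) i, w k (N.endParam i k)

/-- `supp(v)` as a set of points of the network, for `v` continuous on every closed edge. -/
def rollingSupport (v : Fin nE → ℝ → ℝ) : Set (EuclideanSpace ℝ (Fin n)) :=
  ⋃ j, N.param j '' closure {t ∈ Icc 0 (N.len j) | v j t ≠ 0}

/-- `u^f(x) = max_{y ∈ supp(f)} [d(y) - 𝒟(x, y)]_+`. -/
def minimalProfile (η f : Fin nE → ℝ → ℝ) (x : EuclideanSpace ℝ (Fin n)) : ℝ :=
  sSup ((fun y => max (N.bdist η y - N.wdist η x y) 0) '' N.sourceSupport f)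

/-! ### Solutions of the sandpiles problem -/

/-- `u` is a viscosity solution of `|Du| - 1/η = 0` at the points of `A`. -/
structure IsViscositySolutionOn (η : Fin nE → ℝ → ℝ) (u : EuclideanSpace ℝ (Fin n) → ℝ)
    (A : Set (EuclideanSpace ℝ (Fin n))) : Prop where
  cont : N.IsContinuous u
  sub : ∀ j, ∀ t ∈ Ioo 0 (N.len j), N.param j t ∈ A → ∀ φ, N.IsC1 φ →
    IsLocalMaxOn (fun x => u x - φ x) N.carrier (N.param j t) →
    |deriv (N.proj φ j) t| - 1 / η j t ≤ 0
  super : ∀ j, ∀ t ∈ Ioo 0 (N.len j), N.param j t ∈ A → ∀ φ, N.IsC1 φ →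
    IsLocalMinOn (fun x => u x - φ x) N.carrier (N.param j t) →
    0 ≤ |deriv (N.proj φ j) t| - 1 / η j t
  super_vertex : ∀ i, i ∉ N.boundary → N.pos i ∈ A → ∀ φ, N.IsC1 φ →
    IsLocalMinOn (fun x => u x - φ x) N.carrier (N.pos i) →
    ∃ j ∈ N.Inc i, ∃ a, N.HasInnerDeriv φ i j a ∧ 0 ≤ |a| - 1 / η j (N.endParam i j)

/-- The set of the points `x` of the network outside its boundary with `v(x) ≠ 0`; a vertex
belongs to it when `v_j` is nonzero there for at least one incident edge. -/
def nonzeroSet (v : Fin nE → ℝ → ℝ) : Set (EuclideanSpace ℝ (Fin n)) :=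
  (⋃ j, N.param j '' {t ∈ Icc 0 (N.len j) | v j t ≠ 0}) \ (N.pos '' N.boundary)

/-- The transmission conditions at the transition vertices. -/
def Transmission (C : Fin nV → Finset (Fin nE) → Fin nE → ℝ)
    (u : EuclideanSpace ℝ (Fin n) → ℝ) (v : Fin nE → ℝ → ℝ) : Prop :=
  ∀ i, i ∉ N.boundary → ∀ j ∈ N.Inc i,
    (¬ N.SlopeDefined u i j → v j (N.endParam i j) = 0) ∧
    (j ∈ N.IncMinus u i → v j (N.endParam i j) =
      C i (N.IncMinus u i) j * ∑ k ∈ N.IncPlus u i, v k (N.endParam i k))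

/-- `(u, v)` is a solution of the sandpiles problem on the network. -/
structure IsSolution (η f : Fin nE → ℝ → ℝ) (C : Fin nV → Finset (Fin nE) → Fin nE → ℝ)
    (u : EuclideanSpace ℝ (Fin n) → ℝ) (v : Fin nE → ℝ → ℝ) : Prop where
  v_cont : ∀ j, ContinuousOn (v j) (Icc 0 (N.len j))
  v_nonneg : ∀ j, ∀ t ∈ Icc 0 (N.len j), 0 ≤ v j t
  u_nonneg : ∀ x ∈ N.carrier, 0 ≤ u x
  viscosity : N.IsViscositySolutionOn η u (N.nonzeroSet v)
  /-- `u ∈ (W^{1,∞} ∩ C)(𝒩)`, `η |Du| ≤ 1` almost everywhere, and the weak equation holds -/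
  weak : ∃ Du : Fin nE → ℝ → ℝ, N.HasDu u Du ∧
    (∀ j, ∀ᵐ t ∂(volume.restrict (Ioo 0 (N.len j))), η j t * |Du j t| ≤ 1) ∧
    ∀ (ψ : EuclideanSpace ℝ (Fin n) → ℝ) (Dψ : Fin nE → ℝ → ℝ), N.HasDu ψ Dψ →
      (∀ i ∈ N.boundary, ψ (N.pos i) = 0) →
      ∑ j, ∫ t in (0 : ℝ)..N.len j, v j t * η j t * Du j t * Dψ j t =
        ∑ j, ∫ t in (0 : ℝ)..N.len j, f j t * N.proj ψ j t
  dirichlet : ∀ i ∈ N.boundary, u (N.pos i) = 0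
  transmission : N.Transmission C u v

end Network

end

/-! ### Primitives and weak derivatives on an interval -/

/-- Integration by parts for two primitives. -/
theorem integral_mul_primitive_add {f g : ℝ → ℝ} {l : ℝ}
    (hf : IntervalIntegrable f volume 0 l) (hg : IntervalIntegrable g volume 0 l) :
    (∫ t in (0 : ℝ)..l, f t * ∫ s in (0 : ℝ)..t, g s) +
      (∫ t in (0 : ℝ)..l, (∫ s in (0 : ℝ)..t, f s) * g t) =
      (∫ t in (0 : ℝ)..l, f t) * ∫ t in (0 : ℝ)..l, g t := by
  have hF := hf.absolutelyContinuousOnInterval_intervalIntegral (c := 0) (by simp)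
  have hG := hg.absolutelyContinuousOnInterval_intervalIntegral (c := 0) (by simp)
  have h := hF.integral_deriv_mul_eq_sub hG
  rw [← intervalIntegral.integral_add (hf.mul_continuousOn hG.continuousOn)
    (hg.continuousOn_mul hF.continuousOn)]
  simp only [intervalIntegral.integral_same, zero_mul, sub_zero] at h
  rw [← h]
  apply intervalIntegral.integral_congr_ae
  filter_upwards [hf.ae_hasDerivAt_integral, hg.ae_hasDerivAt_integral] with x h1 h2 hx
  have hx' := uIoc_subset_uIcc hx
  rw [(h1 hx' 0 (by simp)).deriv, (h2 hx' 0 (by simp)).deriv]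

theorem MeasureTheory.MemLp.intervalIntegrable_of_top {g : ℝ → ℝ} {l : ℝ} (hl : 0 ≤ l)
    (hg : MemLp g ⊤ (volume.restrict (Ioo 0 l))) : IntervalIntegrable g volume 0 l := by
  rw [intervalIntegrable_iff_integrableOn_Ioo_of_le hl]
  exact hg.integrable (by simp)

theorem MeasureTheory.MemLp.intervalIntegrable_sub {g : ℝ → ℝ} {l s t : ℝ}
    (hg : MemLp g ⊤ (volume.restrict (Ioo 0 l))) (hs : s ∈ Icc 0 l) (ht : t ∈ Icc 0 l) :
    IntervalIntegrable g volume s t :=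
  (hg.intervalIntegrable_of_top (hs.1.trans hs.2)).mono_set (by
    rw [uIcc_of_le (hs.1.trans hs.2)]; exact uIcc_subset_Icc hs ht)

theorem MeasureTheory.MemLp.continuousOn_primitive {g : ℝ → ℝ} {l : ℝ} (hl : 0 ≤ l)
    (hg : MemLp g ⊤ (volume.restrict (Ioo 0 l))) :
    ContinuousOn (fun t => ∫ s in (0 : ℝ)..t, g s) (Icc 0 l) := by
  have h := (hg.intervalIntegrable_of_top hl).absolutelyContinuousOnInterval_intervalIntegral
    (c := 0) (by simp)
  simpa [uIcc_of_le hl] using h.continuousOn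

theorem memLp_top_of_continuousOn {w : ℝ → ℝ} {l : ℝ} (hw : ContinuousOn w (Icc 0 l)) :
    MemLp w ⊤ (volume.restrict (Ioo 0 l)) := by
  obtain ⟨B, hB⟩ := isCompact_Icc.exists_bound_of_continuousOn hw
  refine memLp_top_of_bound
    ((hw.mono Ioo_subset_Icc_self).aestronglyMeasurable measurableSet_Ioo) B ?_
  filter_upwards [ae_restrict_mem measurableSet_Ioo] with t ht
  exact hB t (Ioo_subset_Icc_self ht)

namespace Network

theorem HasSobolevDeriv.congr {l : ℝ} {w w' g : ℝ → ℝ} (h : HasSobolevDeriv l w g)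
    (hw : EqOn w' w (Icc 0 l)) : HasSobolevDeriv l w' g := by
  have hae : w =ᵐ[volume.restrict (Ioo 0 l)] w' := by
    filter_upwards [ae_restrict_mem measurableSet_Ioo] with t ht
    exact (hw (Ioo_subset_Icc_self ht)).symm
  refine ⟨h.1.ae_eq hae, h.2.1, fun φ h1 h2 h3 => ?_⟩
  rw [← h.2.2 φ h1 h2 h3]
  apply integral_congr_ae
  filter_upwards [hae] with t ht
  rw [ht]

theorem hasSobolevDeriv_primitive {l : ℝ} (hl : 0 < l) {g : ℝ → ℝ}
    (hg : MemLp g ⊤ (volume.restrict (Ioo 0 l))) (A : ℝ) :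
    HasSobolevDeriv l (fun t => A + ∫ s in (0 : ℝ)..t, g s) g := by
  have hcont := hg.continuousOn_primitive hl.le
  refine ⟨memLp_top_of_continuousOn (continuousOn_const.add hcont), hg, fun φ hφ _ hsupp => ?_⟩
  have hgi := hg.intervalIntegrable_of_top hl.le
  have hd : Continuous (deriv φ) := hφ.continuous_deriv (by simp)
  have h0 : φ 0 = 0 := by
    by_contra h
    exact lt_irrefl _ (hsupp (subset_tsupport _ h)).1
  have h1 : φ l = 0 := by
    by_contra h
    exact lt_irrefl _ (hsupp (subset_tsupport _ h)).2
  have hφd : ∀ t, ∫ s in (0 : ℝ)..t, deriv φ s = φ t := by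
    intro t
    rw [intervalIntegral.integral_deriv_eq_sub (fun x _ => (hφ.differentiable (by simp)) x)
      (hd.intervalIntegrable _ _), h0, sub_zero]
  have h := integral_mul_primitive_add (hd.intervalIntegrable 0 l) hgi
  simp only [hφd, h1, zero_mul] at h
  rw [← integral_Ioc_eq_integral_Ioo, ← integral_Ioc_eq_integral_Ioo,
    ← intervalIntegral.integral_of_le hl.le, ← intervalIntegral.integral_of_le hl.le]
  have h2 : ∫ t in (0 : ℝ)..l, (A + ∫ s in (0 : ℝ)..t, g s) * deriv φ t =
      A * (∫ t in (0 : ℝ)..l, deriv φ t) + ∫ t in (0 : ℝ)..l, deriv φ t * ∫ s in (0 : ℝ)..t, g s := by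
    rw [← intervalIntegral.integral_const_mul, ← intervalIntegral.integral_add]
    · congr 1; ext t; ring
    · exact (hd.intervalIntegrable _ _).const_mul A
    · refine (hd.intervalIntegrable _ _).mul_continuousOn ?_
      rwa [uIcc_of_le hl.le]
  rw [h2, hφd, h1]
  have h3 : ∫ t in (0 : ℝ)..l, φ t * g t = ∫ t in (0 : ℝ)..l, g t * φ t := by
    congr 1; ext t; ring
  linarith

/-- A continuous function is the primitive of its weak derivative. -/
theorem HasSobolevDeriv.sub_eq_integral {l : ℝ} {w g : ℝ → ℝ} (h : HasSobolevDeriv l w g)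
    (hw : ContinuousOn w (Icc 0 l)) {s t : ℝ} (hs : s ∈ Icc 0 l) (ht : t ∈ Icc 0 l) :
    w t - w s = ∫ r in s..t, g r := by
  rcases eq_or_lt_of_le (hs.1.trans hs.2) with rfl | hl
  · obtain rfl : s = 0 := le_antisymm hs.2 hs.1
    obtain rfl : t = 0 := le_antisymm ht.2 ht.1
    simp
  have hg := h.2.1
  have hgi := hg.intervalIntegrable_of_top hl.le
  have hGc := hg.continuousOn_primitive hl.le
  obtain ⟨W, hWdef⟩ : ∃ W : ℝ → ℝ, W = fun t => w t - ∫ s in (0 : ℝ)..t, g s := ⟨_, rfl⟩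
  have hWc : ContinuousOn W (Icc 0 l) := by rw [hWdef]; exact hw.sub hGc
  -- the difference has zero weak derivative
  have hW0 : ∀ φ : ℝ → ℝ, ContDiff ℝ ∞ φ → HasCompactSupport φ → tsupport φ ⊆ Ioo 0 l →
      ∫ t in Ioo 0 l, W t * deriv φ t = 0 := by
    intro φ h1 h2 h3
    have e1 := h.2.2 φ h1 h2 h3
    have e2 := (hasSobolevDeriv_primitive hl hg 0).2.2 φ h1 h2 h3
    have hd : Continuous (deriv φ) := h1.continuous_deriv (by simp)
    have i1 : IntegrableOn (fun t => w t * deriv φ t) (Ioo 0 l) :=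
      ((hw.mul hd.continuousOn).integrableOn_Icc).mono_set Ioo_subset_Icc_self
    have i2 : IntegrableOn (fun t => (0 + ∫ s in (0 : ℝ)..t, g s) * deriv φ t) (Ioo 0 l) :=
      (((continuousOn_const.add hGc).mul hd.continuousOn).integrableOn_Icc).mono_set
        Ioo_subset_Icc_self
    have := integral_sub i1 i2
    rw [e1, e2, sub_self] at this
    refine (setIntegral_congr_fun measurableSet_Ioo fun t _ => ?_).trans this
    simp only [hWdef]
    ring
  obtain ⟨ρ, hρ⟩ : ∃ ρ : ContDiffBump (l / 2), ρ.rOut < l / 2 :=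
    ⟨⟨l / 8, l / 4, by linarith, by linarith⟩, by simp only; linarith⟩
  have hρsm : ContDiff ℝ ∞ (ρ.normed volume) := ρ.contDiff_normed
  have hρs : tsupport (ρ.normed volume) ⊆ Ioo 0 l := by
    rw [ρ.tsupport_normed_eq, Real.closedBall_eq_Icc]
    intro x hx
    constructor <;> linarith [hx.1, hx.2]
  have hρ1 : ∫ x, ρ.normed volume x = 1 := ρ.integral_normed
  obtain ⟨c, hc⟩ : ∃ c, c = ∫ t in Ioo 0 l, W t * ρ.normed volume t := ⟨_, rfl⟩
  have hconst : ∀ᵐ x, x ∈ Ioo 0 l → W x - c = 0 := by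
    apply isOpen_Ioo.ae_eq_zero_of_integral_contDiff_smul_eq_zero
    · exact ((hWc.mono Ioo_subset_Icc_self).sub continuousOn_const).locallyIntegrableOn
        measurableSet_Ioo
    intro χ hχ hχc hχs
    obtain ⟨m, hm⟩ : ∃ m, m = ∫ x, χ x := ⟨_, rfl⟩
    obtain ⟨k, hk⟩ : ∃ k : ℝ → ℝ, k = fun x => χ x - m * ρ.normed volume x := ⟨_, rfl⟩
    have hksm : ContDiff ℝ ∞ k := by rw [hk]; exact hχ.sub (contDiff_const.mul hρsm)
    have hkc : Continuous k := hksm.continuous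
    have hks : tsupport k ⊆ Ioo 0 l := by
      have : tsupport k ⊆ tsupport χ ∪ tsupport (ρ.normed volume) := by
        refine closure_minimal ?_ ((isClosed_tsupport _).union (isClosed_tsupport _))
        intro x hx
        by_contra hcon
        rw [mem_union, not_or] at hcon
        apply hx
        rw [hk]
        simp [image_eq_zero_of_notMem_tsupport hcon.1, image_eq_zero_of_notMem_tsupport hcon.2]
      exact this.trans (union_subset hχs hρs)
    have hkcs : HasCompactSupport k :=
      isCompact_Icc.of_isClosed_subset (isClosed_tsupport _) (hks.trans Ioo_subset_Icc_self)
    have hχi : Integrable χ := hχ.continuous.integrable_of_hasCompactSupport hχc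
    have hρi : Integrable (ρ.normed volume) := ρ.integrable_normed
    have hk0 : ∫ x, k x = 0 := by
      rw [hk, integral_sub hχi (hρi.const_mul m), integral_const_mul, hρ1, hm]; ring
    -- the compactly supported primitive
    obtain ⟨a, b, hab, ha, hb, hsub⟩ : ∃ a b : ℝ, a ≤ b ∧ 0 < a ∧ b < l ∧ tsupport k ⊆ Icc a b := by
      rcases (tsupport k).eq_empty_or_nonempty with he | hne
      · exact ⟨l / 2, l / 2, le_rfl, by linarith, by linarith, by rw [he]; exact empty_subset _⟩
      · have hkk : IsCompact (tsupport k) := hkcs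
        obtain ⟨a, ha, hal⟩ := hkk.exists_isLeast hne
        obtain ⟨b, hb, hbu⟩ := hkk.exists_isGreatest hne
        exact ⟨a, b, hbu ha, (hks ha).1, (hks hb).2, fun x hx => ⟨hal hx, hbu hx⟩⟩
    have hkz : ∀ x, x ∉ Icc a b → k x = 0 := fun x hx =>
      image_eq_zero_of_notMem_tsupport fun hx' => hx (hsub hx')
    obtain ⟨φ, hφ⟩ : ∃ φ : ℝ → ℝ, φ = fun t => ∫ s in (0 : ℝ)..t, k s := ⟨_, rfl⟩
    have hφd : ∀ t, HasDerivAt φ (k t) t := by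
      intro t
      rw [hφ]
      exact intervalIntegral.integral_hasDerivAt_right (hkc.intervalIntegrable _ _)
        (hkc.stronglyMeasurableAtFilter _ _) hkc.continuousAt
    have hφderiv : deriv φ = k := funext fun t => (hφd t).deriv
    have hφsm : ContDiff ℝ ∞ φ := by
      rw [contDiff_infty_iff_deriv, hφderiv]
      exact ⟨fun t => (hφd t).differentiableAt, hksm⟩
    have hφz1 : ∀ t < a, φ t = 0 := by
      intro t hta
      rw [hφ]
      refine (intervalIntegral.integral_congr (g := fun _ => (0 : ℝ)) ?_).trans (by simp)
      intro x hx
      refine hkz x fun hx' => ?_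
      have := (mem_uIcc.1 hx)
      rcases this with h | h <;> linarith [hx'.1, h.1, h.2]
    have hφz2 : ∀ t, b < t → φ t = 0 := by
      intro t hbt
      rw [hφ, ← hk0]
      simp only
      rw [intervalIntegral.integral_of_le (by linarith)]
      apply setIntegral_eq_integral_of_forall_compl_eq_zero
      intro x hx
      refine hkz x fun hx' => hx ⟨by linarith [hx'.1], by linarith [hx'.2]⟩
    have hφs : tsupport φ ⊆ Icc a b := by
      refine closure_minimal ?_ isClosed_Icc
      intro x hx
      by_contra hcon
      rw [mem_Icc, not_and_or, not_le, not_le] at hcon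
      rcases hcon with h | h
      · exact hx (hφz1 x h)
      · exact hx (hφz2 x h)
    have key := hW0 φ hφsm (isCompact_Icc.of_isClosed_subset (isClosed_tsupport _) hφs)
      (hφs.trans fun x hx => ⟨by linarith [hx.1], by linarith [hx.2]⟩)
    rw [hφderiv] at key
    have hχe : ∫ x, χ x • (W x - c) = ∫ x in Ioo 0 l, χ x * (W x - c) := by
      symm
      apply setIntegral_eq_integral_of_forall_compl_eq_zero
      intro x hx
      rw [image_eq_zero_of_notMem_tsupport fun hx' => hx (hχs hx'), zero_mul]
    have hm' : ∫ x in Ioo 0 l, χ x = m := by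
      rw [hm]
      apply setIntegral_eq_integral_of_forall_compl_eq_zero
      intro x hx
      exact image_eq_zero_of_notMem_tsupport fun hx' => hx (hχs hx')
    have i1 : IntegrableOn (fun t => W t * χ t) (Ioo 0 l) :=
      ((hWc.mul hχ.continuous.continuousOn).integrableOn_Icc).mono_set Ioo_subset_Icc_self
    have i2 : IntegrableOn (fun t => W t * ρ.normed volume t) (Ioo 0 l) :=
      ((hWc.mul hρsm.continuous.continuousOn).integrableOn_Icc).mono_set Ioo_subset_Icc_self
    have e3 : ∫ t in Ioo 0 l, W t * k t = (∫ t in Ioo 0 l, W t * χ t) - m * c := by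
      rw [hc, ← integral_const_mul, ← integral_sub i1 (i2.const_mul m)]
      congr 1; ext t; rw [hk]; ring
    have e4 : ∫ t in Ioo 0 l, χ t * (W t - c) = (∫ t in Ioo 0 l, W t * χ t) - c * m := by
      rw [← hm', ← integral_const_mul, ← integral_sub i1 (hχi.integrableOn.const_mul c)]
      congr 1; ext t; ring
    rw [hχe, e4]
    linarith
  have hWeq : EqOn W (fun _ => c) (Icc 0 l) := by
    apply Measure.eqOn_Icc_of_ae_eq volume hl.ne _ hWc continuousOn_const
    rw [Filter.EventuallyEq, ← restrict_Ioo_eq_restrict_Icc, ae_restrict_iff' measurableSet_Ioo]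
    filter_upwards [hconst] with x hx hx'
    linarith [hx hx']
  have h1 := hWeq hs
  have h2 := hWeq ht
  rw [hWdef] at h1 h2
  simp only at h1 h2
  have h3 := intervalIntegral.integral_interval_sub_left
    (hg.intervalIntegrable_sub (left_mem_Icc.2 hl.le) ht)
    (hg.intervalIntegrable_sub (left_mem_Icc.2 hl.le) hs)
  linarith

end Network

/-! ### The eikonal equation on an interval -/

/-- Comparison for supersolutions of the eikonal equation, tested with the smooth functions
`-(1 - ε) √((G - G t₀)² + δ²)` of slope less than one with respect to `G`. -/
theorem min_le_of_eikonal_supersolution {u G : ℝ → ℝ} {a b : ℝ}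
    (hu : ContinuousOn u (Icc a b)) (hG : Continuous G) (hGm : StrictMono G)
    (hmin : ∀ t₀ ε δ, 0 < ε → ε < 1 → 0 < δ → ∀ t₁ ∈ Ioo a b,
      ¬ IsLocalMin (fun t => u t - -((1 - ε) * √((G t - G t₀) ^ 2 + δ ^ 2))) t₁)
    {t₀ : ℝ} (ht₀ : t₀ ∈ Icc a b) :
    min (u a + (G t₀ - G a)) (u b + (G b - G t₀)) ≤ u t₀ := by
  by_contra! hlt
  rw [lt_min_iff] at hlt
  obtain ⟨h1, h2⟩ := hlt
  have hat : a < t₀ := lt_of_le_of_ne ht₀.1 (by rintro rfl; simp at h1)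
  have htb : t₀ < b := lt_of_le_of_ne ht₀.2 (by rintro rfl; simp at h2)
  obtain ⟨A, hA⟩ : ∃ A, A = G t₀ - G a := ⟨_, rfl⟩
  obtain ⟨B, hB⟩ : ∃ B, B = G b - G t₀ := ⟨_, rfl⟩
  have hA0 : 0 < A := by rw [hA]; linarith [hGm hat]
  have hB0 : 0 < B := by rw [hB]; linarith [hGm htb]
  obtain ⟨m, hm0, hma, hmb⟩ : ∃ m, 0 < m ∧ m ≤ u a + A - u t₀ ∧ m ≤ u b + B - u t₀ :=
    ⟨min (u a + A - u t₀) (u b + B - u t₀), lt_min (by rw [hA]; linarith) (by rw [hB]; linarith),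
      min_le_left _ _, min_le_right _ _⟩
  obtain ⟨ε, hε⟩ : ∃ ε, ε = m / (2 * (A + B + m)) := ⟨_, rfl⟩
  have hden : 0 < 2 * (A + B + m) := by positivity
  have hε0 : 0 < ε := by rw [hε]; positivity
  have hε1 : ε < 1 := by rw [hε, div_lt_one hden]; linarith
  have hεe : ε * A + ε * B + ε * m = m / 2 := by rw [hε]; field_simp
  have hεm : 0 < ε * m := by positivity
  have hεA : 0 < ε * A := by positivity
  have hεB : 0 < ε * B := by positivity
  obtain ⟨w, hw⟩ : ∃ w : ℝ → ℝ,
    w = fun t => u t - -((1 - ε) * √((G t - G t₀) ^ 2 + (m / 4) ^ 2)) := ⟨_, rfl⟩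
  have hwc : ContinuousOn w (Icc a b) := by
    rw [hw]
    exact hu.sub (Continuous.continuousOn (by fun_prop))
  obtain ⟨t₁, ht₁, hmin₁⟩ := isCompact_Icc.exists_isMinOn ⟨t₀, ht₀⟩ hwc
  have hw0 : w t₀ = u t₀ + (1 - ε) * (m / 4) := by
    rw [hw]; simp [Real.sqrt_sq (show 0 ≤ m / 4 by positivity)]
  have hle : ∀ x : ℝ, |x| ≤ √(x ^ 2 + (m / 4) ^ 2) := fun x =>
    Real.abs_le_sqrt (by nlinarith [sq_nonneg (m / 4)])
  have hwa : u a + (1 - ε) * A ≤ w a := by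
    have := hle (G a - G t₀)
    rw [abs_sub_comm, abs_of_pos (by linarith)] at this
    replace this : A ≤ _ := hA.trans_le this
    have := mul_le_mul_of_nonneg_left this (sub_nonneg.2 hε1.le)
    rw [hw]
    simp only
    linarith
  have hwb : u b + (1 - ε) * B ≤ w b := by
    have := hle (G b - G t₀)
    rw [abs_of_pos (by linarith)] at this
    replace this : B ≤ _ := hB.trans_le this
    have := mul_le_mul_of_nonneg_left this (sub_nonneg.2 hε1.le)
    rw [hw]
    simp only
    linarith
  have hle₁ : w t₁ ≤ w t₀ := hmin₁ ht₀
  have hne_a : t₁ ≠ a := by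
    rintro rfl
    nlinarith
  have hne_b : t₁ ≠ b := by
    rintro rfl
    nlinarith
  have ht₁' : t₁ ∈ Ioo a b := ⟨lt_of_le_of_ne ht₁.1 hne_a.symm, lt_of_le_of_ne ht₁.2 hne_b⟩
  refine hmin t₀ ε (m / 4) hε0 hε1 (by positivity) t₁ ht₁' ?_
  rw [← hw]
  exact hmin₁.isLocalMin (Icc_mem_nhds ht₁'.1 ht₁'.2)

/-- A function bounded above by another one with the same integral agrees with it. -/
theorem ae_eq_of_le_of_integral_eq {g h : ℝ → ℝ} {a b : ℝ} (hab : a ≤ b)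
    (hg : IntervalIntegrable g volume a b) (hh : IntervalIntegrable h volume a b)
    (hle : ∀ᵐ t ∂(volume.restrict (Ioo a b)), g t ≤ h t)
    (heq : ∫ t in a..b, g t = ∫ t in a..b, h t) :
    ∀ᵐ t ∂(volume.restrict (Ioo a b)), g t = h t := by
  have hi : IntegrableOn (fun t => h t - g t) (Ioo a b) :=
    (intervalIntegrable_iff_integrableOn_Ioo_of_le hab).1 (hh.sub hg)
  have h0 : ∫ t in Ioo a b, (h t - g t) = 0 := by
    rw [← integral_Ioc_eq_integral_Ioo, ← intervalIntegral.integral_of_le hab,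
      intervalIntegral.integral_sub hh hg, heq, sub_self]
  rw [integral_eq_zero_iff_of_nonneg_ae] at h0
  · filter_upwards [h0] with t ht
    simp only [Pi.zero_apply] at ht
    linarith
  · filter_upwards [hle] with t ht
    simpa using ht
  · exact hi

namespace Network

variable {n nV nE : ℕ} (N : Network n nV nE)

/-! ### Points, neighbourhoods and gluing -/

theorem mem_Inc {i : Fin nV} {j : Fin nE} : j ∈ N.Inc i ↔ N.src j = i ∨ N.tgt j = i := by
  simp [Inc]

theorem src_ne_tgt (j : Fin nE) : N.src j ≠ N.tgt j := by
  intro h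
  have := N.injOn_param j (left_mem_Icc.2 (N.len_pos j).le) (right_mem_Icc.2 (N.len_pos j).le)
    (by rw [N.param_zero, N.param_len, h])
  exact (N.len_pos j).ne this

theorem zero_mem (j : Fin nE) : (0 : ℝ) ∈ Icc 0 (N.len j) := left_mem_Icc.2 (N.len_pos j).le

theorem len_mem (j : Fin nE) : N.len j ∈ Icc 0 (N.len j) := right_mem_Icc.2 (N.len_pos j).le

theorem endParam_src (j : Fin nE) : N.endParam (N.src j) j = 0 := by simp [endParam]

theorem endParam_tgt (j : Fin nE) : N.endParam (N.tgt j) j = N.len j := by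
  simp [endParam, N.src_ne_tgt]

theorem endParam_mem (i : Fin nV) (j : Fin nE) : N.endParam i j ∈ Icc 0 (N.len j) := by
  unfold endParam
  split_ifs
  · exact N.zero_mem j
  · exact N.len_mem j

theorem param_endParam {i : Fin nV} {j : Fin nE} (h : j ∈ N.Inc i) :
    N.param j (N.endParam i j) = N.pos i := by
  rcases N.mem_Inc.1 h with rfl | rfl
  · rw [endParam_src, param_zero]
  · rw [endParam_tgt, param_len]

theorem src_mem_Inc (j : Fin nE) : j ∈ N.Inc (N.src j) := N.mem_Inc.2 (Or.inl rfl)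

theorem tgt_mem_Inc (j : Fin nE) : j ∈ N.Inc (N.tgt j) := N.mem_Inc.2 (Or.inr rfl)

theorem eq_endParam_of_param_eq_pos {i : Fin nV} {j : Fin nE} {t : ℝ}
    (ht : t ∈ Icc 0 (N.len j)) (h : N.param j t = N.pos i) :
    j ∈ N.Inc i ∧ t = N.endParam i j := by
  have hnot : t ∉ Ioo 0 (N.len j) := fun ht' => N.edge_disjoint_vertices j t ht' i h
  rcases eq_or_lt_of_le ht.1 with rfl | h0
  · rw [N.param_zero] at h
    obtain rfl := N.pos_injective h
    exact ⟨N.src_mem_Inc j, (N.endParam_src j).symm⟩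
  rcases eq_or_lt_of_le ht.2 with rfl | h1
  · rw [N.param_len] at h
    obtain rfl := N.pos_injective h
    exact ⟨N.tgt_mem_Inc j, (N.endParam_tgt j).symm⟩
  exact (hnot ⟨h0, h1⟩).elim

theorem endParam_injective {i k : Fin nV} {j : Fin nE} (hi : j ∈ N.Inc i) (hk : j ∈ N.Inc k)
    (h : N.endParam i j = N.endParam k j) : i = k := by
  apply N.pos_injective
  rw [← N.param_endParam hi, ← N.param_endParam hk, h]

theorem eq_of_param_eq_param {j k : Fin nE} {s t : ℝ} (hs : s ∈ Icc 0 (N.len k))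
    (ht : t ∈ Ioo 0 (N.len j)) (h : N.param k s = N.param j t) : k = j ∧ s = t := by
  by_cases hs' : s ∈ Ioo 0 (N.len k)
  · by_cases hkj : k = j
    · subst hkj
      exact ⟨rfl, N.injOn_param _ hs (Ioo_subset_Icc_self ht) h⟩
    · exact (disjoint_left.1 (N.edges_disjoint k j hkj) ⟨s, hs', rfl⟩ ⟨t, ht, h.symm⟩).elim
  · exfalso
    rcases eq_or_lt_of_le hs.1 with rfl | h0
    · exact N.edge_disjoint_vertices j t ht _ (h.symm.trans (N.param_zero k))
    rcases eq_or_lt_of_le hs.2 with rfl | h1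
    · exact N.edge_disjoint_vertices j t ht _ (h.symm.trans (N.param_len k))
    exact hs' ⟨h0, h1⟩

theorem continuousOn_param (j : Fin nE) : ContinuousOn (N.param j) (Icc 0 (N.len j)) :=
  (N.contDiffOn_param j).continuousOn

theorem isClosed_edge_image (j : Fin nE) {K : Set ℝ} (hK : IsClosed K)
    (hs : K ⊆ Icc 0 (N.len j)) : IsClosed (N.param j '' K) :=
  ((isCompact_Icc.of_isClosed_subset hK hs).image_of_continuousOn
    ((N.continuousOn_param j).mono hs)).isClosed

/-- Functions on the edges with common values at the vertices are the projections of a function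
on the network. -/
theorem exists_proj_eq (γ : Fin nV → ℝ) (φ : Fin nE → ℝ → ℝ)
    (h0 : ∀ j, φ j 0 = γ (N.src j)) (h1 : ∀ j, φ j (N.len j) = γ (N.tgt j)) :
    ∃ ψ : EuclideanSpace ℝ (Fin n) → ℝ, (∀ i, ψ (N.pos i) = γ i) ∧
      ∀ j, EqOn (N.proj ψ j) (φ j) (Icc 0 (N.len j)) := by
  classical
  have hx : ∀ x : EuclideanSpace ℝ (Fin n), ∃ y : ℝ, (∀ i, x = N.pos i → y = γ i) ∧
      ∀ j, ∀ t ∈ Icc 0 (N.len j), x = N.param j t → y = φ j t := by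
    intro x
    have hend : ∀ i j t, t ∈ Icc 0 (N.len j) → N.pos i = N.param j t → γ i = φ j t := by
      intro i j t ht h
      obtain ⟨hj, rfl⟩ := N.eq_endParam_of_param_eq_pos ht h.symm
      rcases N.mem_Inc.1 hj with rfl | rfl
      · rw [endParam_src, h0]
      · rw [endParam_tgt, h1]
    by_cases hv : ∃ i, x = N.pos i
    · obtain ⟨i, rfl⟩ := hv
      exact ⟨γ i, fun k hk => by rw [N.pos_injective hk], fun j t ht h => hend i j t ht h⟩
    by_cases he : ∃ j, ∃ t ∈ Icc 0 (N.len j), x = N.param j t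
    · obtain ⟨j, t, ht, rfl⟩ := he
      have ht' : t ∈ Ioo 0 (N.len j) := by
        refine ⟨lt_of_le_of_ne ht.1 ?_, lt_of_le_of_ne ht.2 ?_⟩
        · rintro rfl; exact hv ⟨_, N.param_zero j⟩
        · rintro rfl; exact hv ⟨_, N.param_len j⟩
      refine ⟨φ j t, fun i hi => (hv ⟨i, hi⟩).elim, fun k s hs h => ?_⟩
      obtain ⟨rfl, rfl⟩ := N.eq_of_param_eq_param hs ht' h.symm
      rfl
    · exact ⟨0, fun i hi => (hv ⟨i, hi⟩).elim, fun j t ht h => (he ⟨j, t, ht, h⟩).elim⟩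
  choose ψ hψ using hx
  exact ⟨ψ, fun i => (hψ _).1 i rfl, fun j t ht => (hψ _).2 j t ht rfl⟩

/-- Near an interior point of an edge, the network consists of that edge. -/
theorem eventually_nhdsWithin_carrier_of_edge {j : Fin nE} {t : ℝ} (ht : t ∈ Ioo 0 (N.len j))
    {p : EuclideanSpace ℝ (Fin n) → Prop} (h : ∀ᶠ s in 𝓝 t, p (N.param j s)) :
    ∀ᶠ x in 𝓝[N.carrier] N.param j t, p x := by
  obtain ⟨W, hW, hWo, htW⟩ := eventually_nhds_iff.1 h
  obtain ⟨K, hK⟩ : ∃ K : Set (EuclideanSpace ℝ (Fin n)), K = range N.pos ∪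
    ((⋃ k ∈ {k | k ≠ j}, N.param k '' Icc 0 (N.len k)) ∪ N.param j '' (Icc 0 (N.len j) \ W)) :=
    ⟨_, rfl⟩
  have hKc : IsClosed K := by
    rw [hK]
    refine (finite_range _).isClosed.union (IsClosed.union ?_ ?_)
    · exact (Set.toFinite _).isClosed_biUnion
        fun k _ => N.isClosed_edge_image k isClosed_Icc Subset.rfl
    · exact N.isClosed_edge_image j (isClosed_Icc.sdiff hWo) sdiff_subset
  have hnK : N.param j t ∉ K := by
    rw [hK]
    rintro (⟨i, hi⟩ | h | ⟨s, hs, h⟩)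
    · exact N.edge_disjoint_vertices j t ht i hi.symm
    · simp only [mem_iUnion] at h
      obtain ⟨k, hk, s, hs, h⟩ := h
      exact hk (N.eq_of_param_eq_param hs ht h).1
    · exact hs.2 ((N.eq_of_param_eq_param hs.1 ht h).2 ▸ htW)
  rw [eventually_nhdsWithin_iff]
  filter_upwards [hKc.isOpen_compl.mem_nhds hnK] with x hx hxc
  rw [mem_compl_iff, hK, mem_union, mem_union, not_or, not_or] at hx
  rcases hxc with h | h
  · exact (hx.1 h).elim
  obtain ⟨k, s, hs, rfl⟩ := mem_iUnion.1 h
  by_cases hkj : k = j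
  · subst hkj
    by_contra hp
    exact hx.2.2 ⟨s, ⟨hs, fun hsW => hp (hW s hsW)⟩, rfl⟩
  · exact (hx.2.1 (mem_iUnion₂.2 ⟨k, hkj, s, hs, rfl⟩)).elim

/-- Near a vertex, the network consists of the incident edges. -/
theorem eventually_nhdsWithin_carrier_of_vertex {i : Fin nV}
    {p : EuclideanSpace ℝ (Fin n) → Prop} (hi : p (N.pos i))
    (h : ∀ j ∈ N.Inc i, ∀ t ∈ Icc 0 (N.len j), p (N.param j t)) :
    ∀ᶠ x in 𝓝[N.carrier] N.pos i, p x := by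
  obtain ⟨K, hK⟩ : ∃ K : Set (EuclideanSpace ℝ (Fin n)), K = N.pos '' {k | k ≠ i} ∪
    ⋃ k ∈ {k | k ∉ N.Inc i}, N.param k '' Icc 0 (N.len k) := ⟨_, rfl⟩
  have hKc : IsClosed K := by
    rw [hK]
    refine (Set.toFinite _).isClosed.union ?_
    exact (Set.toFinite _).isClosed_biUnion
      fun k _ => N.isClosed_edge_image k isClosed_Icc Subset.rfl
  have hnK : N.pos i ∉ K := by
    rw [hK]
    rintro (⟨k, hk, h⟩ | h)
    · exact hk (N.pos_injective h)
    · simp only [mem_iUnion] at h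
      obtain ⟨k, hk, s, hs, h⟩ := h
      exact hk (N.eq_endParam_of_param_eq_pos hs h).1
  rw [eventually_nhdsWithin_iff]
  filter_upwards [hKc.isOpen_compl.mem_nhds hnK] with x hx hxc
  rw [mem_compl_iff, hK, mem_union, not_or] at hx
  rcases hxc with ⟨k, rfl⟩ | h'
  · by_cases hk : k = i
    · exact hk ▸ hi
    · exact (hx.1 ⟨k, hk, rfl⟩).elim
  obtain ⟨k, s, hs, rfl⟩ := mem_iUnion.1 h'
  by_cases hk : k ∈ N.Inc i
  · exact h k hk s hs
  · exact (hx.2 (mem_iUnion₂.2 ⟨k, hk, s, hs, rfl⟩)).elim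

/-! ### The weighted arc length of the edges -/

/-- The weighted length of the `j`-th edge up to the parameter `t`. -/
noncomputable def arc (η : Fin nE → ℝ → ℝ) (j : Fin nE) (t : ℝ) : ℝ :=
  ∫ r in (0 : ℝ)..t, 1 / η j (projIcc 0 (N.len j) (N.len_pos j).le r)

variable {N} {η : Fin nE → ℝ → ℝ}

theorem IsCapacity.pos (hη : N.IsCapacity η) {j : Fin nE} {t : ℝ} (ht : t ∈ Icc 0 (N.len j)) :
    0 < η j t := (hη j).2 t ht

theorem IsCapacity.continuous_density (hη : N.IsCapacity η) (j : Fin nE) :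
    Continuous fun r => 1 / η j (projIcc 0 (N.len j) (N.len_pos j).le r) := by
  have h : Continuous fun x : Icc 0 (N.len j) => η j x :=
    continuousOn_iff_continuous_domRestrict.1 (hη j).1
  refine continuous_const.div (h.comp continuous_projIcc) fun r => (hη.pos ?_).ne'
  exact Subtype.mem _

theorem IsCapacity.hasDerivAt_arc' (hη : N.IsCapacity η) (j : Fin nE) (t : ℝ) :
    HasDerivAt (N.arc η j) (1 / η j (projIcc 0 (N.len j) (N.len_pos j).le t)) t := by
  have hc := hη.continuous_density j
  exact intervalIntegral.integral_hasDerivAt_right (hc.intervalIntegrable _ _)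
    (hc.stronglyMeasurableAtFilter _ _) hc.continuousAt

theorem IsCapacity.hasDerivAt_arc (hη : N.IsCapacity η) {j : Fin nE} {t : ℝ}
    (ht : t ∈ Icc 0 (N.len j)) : HasDerivAt (N.arc η j) (1 / η j t) t := by
  have h := hη.hasDerivAt_arc' j t
  rwa [projIcc_of_mem _ ht] at h

theorem IsCapacity.contDiff_arc (hη : N.IsCapacity η) (j : Fin nE) :
    ContDiff ℝ 1 (N.arc η j) := by
  rw [contDiff_one_iff_deriv]
  refine ⟨fun t => (hη.hasDerivAt_arc' j t).differentiableAt, ?_⟩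
  rw [show deriv (N.arc η j) = _ from funext fun t => (hη.hasDerivAt_arc' j t).deriv]
  exact hη.continuous_density j

theorem IsCapacity.continuous_arc (hη : N.IsCapacity η) (j : Fin nE) :
    Continuous (N.arc η j) := (hη.contDiff_arc j).continuous

theorem IsCapacity.strictMono_arc (hη : N.IsCapacity η) (j : Fin nE) :
    StrictMono (N.arc η j) := by
  apply strictMono_of_deriv_pos
  intro t
  rw [(hη.hasDerivAt_arc' j t).deriv]
  exact one_div_pos.2 (hη.pos (Subtype.mem _))

theorem arc_zero (j : Fin nE) : N.arc η j 0 = 0 := by simp [arc]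

theorem IsCapacity.integral_one_div (hη : N.IsCapacity η) {j : Fin nE} {s t : ℝ}
    (hs : s ∈ Icc 0 (N.len j)) (ht : t ∈ Icc 0 (N.len j)) :
    ∫ r in s..t, 1 / η j r = N.arc η j t - N.arc η j s := by
  have hc := hη.continuous_density j
  rw [arc, arc, intervalIntegral.integral_interval_sub_left (hc.intervalIntegrable _ _)
    (hc.intervalIntegrable _ _)]
  apply intervalIntegral.integral_congr
  intro r hr
  simp only
  rw [projIcc_of_mem _ (uIcc_subset_Icc hs ht hr)]

theorem IsCapacity.intervalIntegrable_one_div (hη : N.IsCapacity η) {j : Fin nE} {s t : ℝ}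
    (hs : s ∈ Icc 0 (N.len j)) (ht : t ∈ Icc 0 (N.len j)) :
    IntervalIntegrable (fun r => 1 / η j r) volume s t := by
  refine ContinuousOn.intervalIntegrable fun r hr => ?_
  have hr' := uIcc_subset_Icc hs ht hr
  exact (continuousWithinAt_const.div ((hη j).1 r hr') (hη.pos hr').ne').mono
    (uIcc_subset_Icc hs ht)

theorem IsCapacity.subEdgeLength_eq (hη : N.IsCapacity η) {j : Fin nE} {s t : ℝ}
    (hs : s ∈ Icc 0 (N.len j)) (ht : t ∈ Icc 0 (N.len j)) :
    subEdgeLength η j s t = |N.arc η j t - N.arc η j s| := by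
  rw [subEdgeLength, hη.integral_one_div hs ht]

/-! ### Paths -/

variable (N) in
/-- The functions on the network that are nonexpansive on every edge for the weighted length. -/
def EdgeLipschitz (η : Fin nE → ℝ → ℝ) (g : EuclideanSpace ℝ (Fin n) → ℝ) : Prop :=
  ∀ j, ∀ s ∈ Icc 0 (N.len j), ∀ t ∈ Icc 0 (N.len j),
    g (N.param j s) ≤ g (N.param j t) + |N.arc η j t - N.arc η j s|

theorem IsPathLength.nonneg {x y : EuclideanSpace ℝ (Fin n)} {L : ℝ}
    (h : N.IsPathLength η x y L) : 0 ≤ L := by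
  induction h with
  | single => exact abs_nonneg _
  | cons j s hs i hi y L hL ih => exact add_nonneg (abs_nonneg _) ih

theorem EdgeLipschitz.le_add_of_isPathLength {g : EuclideanSpace ℝ (Fin n) → ℝ}
    (hg : N.EdgeLipschitz η g) (hη : N.IsCapacity η) {x y : EuclideanSpace ℝ (Fin n)} {L : ℝ}
    (h : N.IsPathLength η x y L) : g x ≤ g y + L := by
  induction h with
  | single j s t hs ht =>
    rw [hη.subEdgeLength_eq hs ht]
    exact hg j s hs t ht
  | cons j s hs i hi y L hL ih =>
    rw [hη.subEdgeLength_eq hs (N.endParam_mem i j)]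
    have := hg j s hs _ (N.endParam_mem i j)
    rw [N.param_endParam hi] at this
    linarith

theorem bddBelow_pathLength (x y : EuclideanSpace ℝ (Fin n)) :
    BddBelow {L | N.IsPathLength η x y L} := ⟨0, fun _ h => h.nonneg⟩

theorem IsPathLength.wdist_le {x y : EuclideanSpace ℝ (Fin n)} {L : ℝ}
    (h : N.IsPathLength η x y L) : N.wdist η x y ≤ L := csInf_le (bddBelow_pathLength x y) h

theorem wdist_nonneg (x y : EuclideanSpace ℝ (Fin n)) : 0 ≤ N.wdist η x y :=
  Real.sInf_nonneg fun _ h => h.nonneg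

theorem bdist_nonneg (x : EuclideanSpace ℝ (Fin n)) : 0 ≤ N.bdist η x :=
  Finset.le_inf' _ _ fun _ _ => wdist_nonneg _ _

variable (N) in
theorem exists_mem_Inc (hE : Nonempty (Fin nE)) (i : Fin nV) : ∃ j, j ∈ N.Inc i := by
  obtain ⟨j⟩ := hE
  rcases Relation.ReflTransGen.cases_head (N.connected i (N.src j)) with h | ⟨k, ⟨l, hl⟩, -⟩
  · exact ⟨j, N.mem_Inc.2 (Or.inl h.symm)⟩
  · refine ⟨l, N.mem_Inc.2 ?_⟩
    rcases hl with h | h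
    · exact Or.inl h.1
    · exact Or.inr h.2

theorem isPathLength_refl {j : Fin nE} {t : ℝ} (ht : t ∈ Icc 0 (N.len j)) :
    N.IsPathLength η (N.param j t) (N.param j t) 0 := by
  have := IsPathLength.single (η := η) j t t ht ht
  simpa [subEdgeLength] using this

theorem isPathLength_pos_refl (hE : Nonempty (Fin nE)) (i : Fin nV) :
    N.IsPathLength η (N.pos i) (N.pos i) 0 := by
  obtain ⟨j, hj⟩ := N.exists_mem_Inc hE i
  rw [← N.param_endParam hj]
  exact isPathLength_refl (N.endParam_mem i j)

theorem IsPathLength.exists_of_vertex {k : Fin nV} {y : EuclideanSpace ℝ (Fin n)} {L : ℝ}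
    (h : N.IsPathLength η (N.pos k) y L) (i : Fin nV) :
    ∃ L, N.IsPathLength η (N.pos i) y L := by
  induction N.connected i k using Relation.ReflTransGen.head_induction_on with
  | refl => exact ⟨L, h⟩
  | @head a c h _ ih =>
    obtain ⟨L, hL⟩ := ih
    obtain ⟨j, hj⟩ := h
    have ha : j ∈ N.Inc a := N.mem_Inc.2 (by tauto)
    have hc : j ∈ N.Inc c := N.mem_Inc.2 (by tauto)
    rw [← N.param_endParam ha]
    exact ⟨_, .cons j _ (N.endParam_mem a j) c hc _ L hL⟩

theorem exists_isPathLength (hE : Nonempty (Fin nE)) (i k : Fin nV) :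
    ∃ L, N.IsPathLength η (N.pos i) (N.pos k) L :=
  (isPathLength_pos_refl hE k).exists_of_vertex i

theorem exists_isPathLength_param {j k : Fin nE} {s t : ℝ} (hs : s ∈ Icc 0 (N.len j))
    (ht : t ∈ Icc 0 (N.len k)) : ∃ L, N.IsPathLength η (N.param j s) (N.param k t) L := by
  have h := IsPathLength.single (η := η) k 0 t (N.zero_mem k) ht
  rw [N.param_zero] at h
  obtain ⟨L, hL⟩ := h.exists_of_vertex (N.src j)
  exact ⟨_, .cons j s hs _ (N.src_mem_Inc j) _ L hL⟩

theorem bdist_boundary (hE : Nonempty (Fin nE)) {i : Fin nV} (hi : i ∈ N.boundary) :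
    N.bdist η (N.pos i) = 0 := by
  refine le_antisymm ?_ (bdist_nonneg _)
  exact (Finset.inf'_le _ hi).trans (isPathLength_pos_refl hE i).wdist_le

theorem EdgeLipschitz.le_bdist {g : EuclideanSpace ℝ (Fin n) → ℝ}
    (hg : N.EdgeLipschitz η g) (hη : N.IsCapacity η)
    (hb : ∀ i ∈ N.boundary, g (N.pos i) = 0) {j : Fin nE} {t : ℝ} (ht : t ∈ Icc 0 (N.len j)) :
    g (N.param j t) ≤ N.bdist η (N.param j t) := by
  refine Finset.le_inf' _ _ fun i hi => le_csInf ?_ fun L hL => ?_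
  · obtain ⟨L, hL⟩ := exists_isPathLength (η := η) ⟨j⟩ (N.src j) i
    exact ⟨_, .cons j t ht _ (N.src_mem_Inc j) _ L hL⟩
  · have := hg.le_add_of_isPathLength hη hL
    rwa [hb i hi, zero_add] at this

theorem bdist_le_of_mem_Inc (hη : N.IsCapacity η) {i : Fin nV} {j : Fin nE} {t : ℝ}
    (hj : j ∈ N.Inc i) (ht : t ∈ Icc 0 (N.len j)) :
    N.bdist η (N.param j t) ≤
      N.bdist η (N.pos i) + |N.arc η j (N.endParam i j) - N.arc η j t| := by
  obtain ⟨k, hk, hmin⟩ := Finset.exists_mem_eq_inf' N.boundary_nonempty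
    fun k => N.wdist η (N.pos i) (N.pos k)
  rw [show N.bdist η (N.pos i) = _ from hmin, ← hη.subEdgeLength_eq ht (N.endParam_mem i j)]
  refine (Finset.inf'_le _ hk).trans ?_
  rw [← sub_le_iff_le_add]
  refine le_csInf (exists_isPathLength ⟨j⟩ i k) fun L hL => ?_
  rw [sub_le_iff_le_add, add_comm]
  exact (IsPathLength.cons j t ht i hj _ L hL).wdist_le

theorem bdist_le_of_path (x : EuclideanSpace ℝ (Fin n)) {k : Fin nV} (hk : k ∈ N.boundary) {L : ℝ}
    (hL : N.IsPathLength η x (N.pos k) L) : N.bdist η x ≤ L :=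
  (Finset.inf'_le _ hk).trans hL.wdist_le

/-- The distance from the boundary along an edge, in terms of its values at the two ends. -/
theorem bdist_param_eq (hη : N.IsCapacity η) {j : Fin nE} {t : ℝ} (ht : t ∈ Icc 0 (N.len j)) :
    N.bdist η (N.param j t) = min (N.bdist η (N.pos (N.src j)) + N.arc η j t)
      (N.bdist η (N.pos (N.tgt j)) + (N.arc η j (N.len j) - N.arc η j t)) := by
  have hmono := (hη.strictMono_arc j).monotone
  have hup : ∀ t ∈ Icc 0 (N.len j), N.bdist η (N.param j t) ≤
      min (N.bdist η (N.pos (N.src j)) + N.arc η j t)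
      (N.bdist η (N.pos (N.tgt j)) + (N.arc η j (N.len j) - N.arc η j t)) := by
    intro t ht
    have h0 := bdist_le_of_mem_Inc hη (N.src_mem_Inc j) ht
    have h1 := bdist_le_of_mem_Inc hη (N.tgt_mem_Inc j) ht
    have hm0 := hmono ht.1
    have hm1 := hmono ht.2
    rw [endParam_src, abs_sub_comm, abs_of_nonneg (by linarith), arc_zero, sub_zero] at h0
    rw [endParam_tgt, abs_of_nonneg (by linarith)] at h1
    exact le_min h0 h1
  refine le_antisymm (hup t ht) ?_
  rcases eq_or_lt_of_le ht.1 with rfl | ht0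
  · rw [N.param_zero, arc_zero, add_zero]
    exact min_le_left _ _
  rcases eq_or_lt_of_le ht.2 with rfl | ht1
  · rw [N.param_len, sub_self, add_zero]
    exact min_le_right _ _
  refine Finset.le_inf' _ _ fun k hk => le_csInf ?_ fun L hL => ?_
  · obtain ⟨L, hL⟩ := exists_isPathLength (η := η) ⟨j⟩ (N.src j) k
    exact ⟨_, .cons j t ht _ (N.src_mem_Inc j) _ L hL⟩
  have hm0 := hmono ht.1
  have hm1 := hmono ht.2
  have key : ∀ (i : Fin nV) (hi : j ∈ N.Inc i) (c : ℝ), N.bdist η (N.pos i) ≤ c →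
      min (N.bdist η (N.pos (N.src j)) + N.arc η j t)
      (N.bdist η (N.pos (N.tgt j)) + (N.arc η j (N.len j) - N.arc η j t)) ≤
        subEdgeLength η j t (N.endParam i j) + c := by
    intro i hi c hc
    rw [hη.subEdgeLength_eq ht (N.endParam_mem i j)]
    rcases N.mem_Inc.1 hi with rfl | rfl
    · refine (min_le_left _ _).trans ?_
      rw [endParam_src, abs_sub_comm, abs_of_nonneg (by linarith), arc_zero]
      linarith
    · refine (min_le_right _ _).trans ?_
      rw [endParam_tgt, abs_of_nonneg (by linarith)]
      linarith
  generalize hx : N.param j t = x at hL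
  generalize hy : N.pos k = y at hL
  cases hL with
  | single j' s' t' hs' ht' =>
    obtain ⟨rfl, rfl⟩ := N.eq_of_param_eq_param hs' ⟨ht0, ht1⟩ hx.symm
    obtain ⟨hk', rfl⟩ := N.eq_endParam_of_param_eq_pos ht' hy.symm
    have := key k hk' 0 (bdist_boundary ⟨j'⟩ hk).le
    linarith
  | cons j' s' hs' i hi y L' hL' =>
    obtain ⟨rfl, rfl⟩ := N.eq_of_param_eq_param hs' ⟨ht0, ht1⟩ hx.symm
    subst hy
    exact key i hi L' (bdist_le_of_path _ hk hL')

end Network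

namespace Network

variable {n nV nE : ℕ} {N : Network n nV nE} {η : Fin nE → ℝ → ℝ}

/-! ### The shape of the distance on the edges -/

variable (N) in
/-- On every edge, the distance from the boundary has unit slope towards the parameter `p j`. -/
structure IsPeak (η : Fin nE → ℝ → ℝ) (p : Fin nE → ℝ) : Prop where
  mem : ∀ j, p j ∈ Icc 0 (N.len j)
  eq : ∀ j, ∀ t ∈ Icc 0 (N.len j),
    N.bdist η (N.param j t) = N.bdist η (N.param j (p j)) - |N.arc η j (p j) - N.arc η j t|

theorem IsCapacity.exists_isPeak (hη : N.IsCapacity η) : ∃ p, N.IsPeak η p := by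
  have h : ∀ j, ∃ q ∈ Icc 0 (N.len j), ∀ t ∈ Icc 0 (N.len j),
      N.bdist η (N.param j t) = N.bdist η (N.param j q) - |N.arc η j q - N.arc η j t| := by
    intro j
    have h0 := bdist_param_eq hη (N.zero_mem j)
    have h1 := bdist_param_eq hη (N.len_mem j)
    rw [N.param_zero, arc_zero, add_zero, sub_zero] at h0
    rw [N.param_len, sub_self, add_zero] at h1
    have h0' := h0.le.trans (min_le_right _ _)
    have h1' := h1.le.trans (min_le_left _ _)
    obtain ⟨q, hq, hqe⟩ := intermediate_value_Icc (N.len_pos j).le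
      (hη.continuous_arc j).continuousOn
      (show (N.bdist η (N.pos (N.tgt j)) - N.bdist η (N.pos (N.src j)) + N.arc η j (N.len j)) / 2 ∈
        Icc (N.arc η j 0) (N.arc η j (N.len j)) by
          rw [arc_zero]; constructor <;> linarith)
    refine ⟨q, hq, fun t ht => ?_⟩
    rw [bdist_param_eq hη hq, bdist_param_eq hη ht, hqe]
    rcases le_total t q with h | h
    · have := (hη.strictMono_arc j).monotone h
      rw [abs_of_nonneg (by linarith), min_eq_left (by linarith), min_eq_left (by linarith)]
      ring
    · have := (hη.strictMono_arc j).monotone h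
      rw [abs_of_nonpos (by linarith), min_eq_right (by linarith), min_eq_right (by linarith)]
      ring
  choose p hp using h
  exact ⟨p, fun j => (hp j).1, fun j => (hp j).2⟩

theorem IsPeak.edgeLipschitz {p : Fin nE → ℝ} (hp : N.IsPeak η p) :
    N.EdgeLipschitz η (N.bdist η) := by
  intro j s hs t ht
  rw [hp.eq j s hs, hp.eq j t ht]
  have := abs_sub_abs_le_abs_sub (N.arc η j (p j) - N.arc η j t) (N.arc η j (p j) - N.arc η j s)
  rw [show N.arc η j (p j) - N.arc η j t - (N.arc η j (p j) - N.arc η j s) =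
    -(N.arc η j t - N.arc η j s) by ring, abs_neg] at this
  linarith

theorem IsPeak.eq_of_le (hη : N.IsCapacity η) {p : Fin nE → ℝ} (hp : N.IsPeak η p) {j : Fin nE}
    {s t : ℝ} (hs : s ∈ Icc 0 (N.len j)) (hst : s ≤ t) (htp : t ≤ p j) :
    N.bdist η (N.param j t) = N.bdist η (N.param j s) + (N.arc η j t - N.arc η j s) := by
  have h1 := (hη.strictMono_arc j).monotone hst
  have h2 := (hη.strictMono_arc j).monotone htp
  rw [hp.eq j s hs, hp.eq j t ⟨hs.1.trans hst, htp.trans (hp.mem j).2⟩,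
    abs_of_nonneg (by linarith), abs_of_nonneg (by linarith)]
  ring

theorem IsPeak.eq_of_ge (hη : N.IsCapacity η) {p : Fin nE → ℝ} (hp : N.IsPeak η p) {j : Fin nE}
    {s t : ℝ} (ht : t ∈ Icc 0 (N.len j)) (hst : s ≤ t) (hps : p j ≤ s) :
    N.bdist η (N.param j s) = N.bdist η (N.param j t) + (N.arc η j t - N.arc η j s) := by
  have h1 := (hη.strictMono_arc j).monotone hst
  have h2 := (hη.strictMono_arc j).monotone hps
  rw [hp.eq j t ht, hp.eq j s ⟨(hp.mem j).1.trans hps, hst.trans ht.2⟩,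
    abs_of_nonpos (by linarith), abs_of_nonpos (by linarith)]
  ring

/-! ### Internal oriented derivatives -/

theorem HasInnerDeriv.unique {g : EuclideanSpace ℝ (Fin n) → ℝ} {i : Fin nV} {j : Fin nE}
    {a b : ℝ} (ha : N.HasInnerDeriv g i j a) (hb : N.HasInnerDeriv g i j b) : a = b :=
  tendsto_nhds_unique ha hb

theorem tendsto_arc_inward (hη : N.IsCapacity η) {i : Fin nV} {j : Fin nE} (hj : j ∈ N.Inc i) :
    Tendsto (fun h => |N.arc η j (N.inward i j h) - N.arc η j (N.endParam i j)| / h) (𝓝[>] 0)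
      (𝓝 (1 / η j (N.endParam i j))) := by
  have hm := (hη.strictMono_arc j).monotone
  rcases N.mem_Inc.1 hj with rfl | rfl
  · have h := (hη.hasDerivAt_arc (N.zero_mem j)).tendsto_slope_zero_right
    rw [endParam_src]
    refine h.congr' ?_
    filter_upwards [self_mem_nhdsWithin] with r hr
    have hr' : (0 : ℝ) < r := hr
    have := hm hr'.le
    simp only [inward, if_true, zero_add, smul_eq_mul]
    rw [abs_of_nonneg (by linarith)]
    field_simp
  · have h0 : HasDerivAt (fun r => -N.arc η j (N.len j - r)) (1 / η j (N.len j)) 0 := by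
      have h1 : HasDerivAt (N.arc η j) (1 / η j (N.len j)) (N.len j - 0) := by
        simpa using hη.hasDerivAt_arc (N.len_mem j)
      simpa using (h1.comp_const_sub (N.len j) 0).fun_neg
    have h := h0.tendsto_slope_zero_right
    rw [endParam_tgt]
    refine h.congr' ?_
    filter_upwards [self_mem_nhdsWithin] with r hr
    have hr' : (0 : ℝ) < r := hr
    have := hm (show N.len j - r ≤ N.len j by linarith)
    simp only [inward, N.src_ne_tgt, if_false, zero_add, smul_eq_mul, sub_zero]
    rw [abs_of_nonpos (by linarith)]
    field_simp
    ring

/-- A function with slope `c` with respect to the weighted length near a vertex. -/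
theorem hasInnerDeriv_of_eventually (hη : N.IsCapacity η) {g : EuclideanSpace ℝ (Fin n) → ℝ}
    {i : Fin nV} {j : Fin nE} (hj : j ∈ N.Inc i) {c : ℝ} {W : Set ℝ}
    (hW : W ∈ 𝓝 (N.endParam i j))
    (h : ∀ t ∈ Icc 0 (N.len j), t ∈ W → g (N.param j t) = g (N.pos i) +
      c * |N.arc η j t - N.arc η j (N.endParam i j)|) :
    N.HasInnerDeriv g i j (c * (1 / η j (N.endParam i j))) := by
  refine ((tendsto_arc_inward hη hj).const_mul c).congr' ?_
  have hin : Tendsto (N.inward i j) (𝓝[>] 0) (𝓝 (N.endParam i j)) := by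
    have : ContinuousAt (N.inward i j) 0 := by
      unfold inward
      split_ifs
      · exact continuousAt_id
      · exact (continuous_const.sub continuous_id).continuousAt
    have h0 : N.inward i j 0 = N.endParam i j := by simp [inward, endParam]
    have := this.tendsto.mono_left (nhdsWithin_le_nhds (s := Ioi 0))
    rwa [h0] at this
  filter_upwards [self_mem_nhdsWithin, hin hW,
    (Ioo_mem_nhdsGT (N.len_pos j))] with r hr hrW hr1
  have hmem : N.inward i j r ∈ Icc 0 (N.len j) := by
    unfold inward
    split_ifs <;> constructor <;> linarith [hr1.1, hr1.2]
  have he : N.proj g j (N.endParam i j) = g (N.pos i) := by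
    rw [proj, N.param_endParam hj]
  rw [he, proj, h _ hmem hrW]
  ring

theorem mem_IncPlus {g : EuclideanSpace ℝ (Fin n) → ℝ} {i : Fin nV} {j : Fin nE} :
    j ∈ N.IncPlus g i ↔ j ∈ N.Inc i ∧ ∃ a, 0 < a ∧ N.HasInnerDeriv g i j a := by
  simp [IncPlus]

theorem mem_IncMinus {g : EuclideanSpace ℝ (Fin n) → ℝ} {i : Fin nV} {j : Fin nE} :
    j ∈ N.IncMinus g i ↔ j ∈ N.Inc i ∧ ∃ a, a < 0 ∧ N.HasInnerDeriv g i j a := by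
  simp [IncMinus]

theorem notMem_IncMinus_of_mem_IncPlus {g : EuclideanSpace ℝ (Fin n) → ℝ} {i : Fin nV}
    {j : Fin nE} (h : j ∈ N.IncPlus g i) : j ∉ N.IncMinus g i := by
  intro h'
  obtain ⟨-, a, ha, hda⟩ := mem_IncPlus.1 h
  obtain ⟨-, b, hb, hdb⟩ := mem_IncMinus.1 h'
  have := hda.unique hdb
  linarith

theorem mem_IncPlus_of_eventually (hη : N.IsCapacity η) {g : EuclideanSpace ℝ (Fin n) → ℝ}
    {i : Fin nV} {j : Fin nE} (hj : j ∈ N.Inc i) {W : Set ℝ} (hW : W ∈ 𝓝 (N.endParam i j))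
    (h : ∀ t ∈ Icc 0 (N.len j), t ∈ W → g (N.param j t) = g (N.pos i) +
      |N.arc η j t - N.arc η j (N.endParam i j)|) : j ∈ N.IncPlus g i := by
  have hpos := hη.pos (N.endParam_mem i j)
  refine mem_IncPlus.2 ⟨hj, _, ?_, hasInnerDeriv_of_eventually hη hj (c := 1) hW
    fun t ht htW => by rw [h t ht htW, one_mul]⟩
  positivity

theorem mem_IncMinus_of_eventually (hη : N.IsCapacity η) {g : EuclideanSpace ℝ (Fin n) → ℝ}
    {i : Fin nV} {j : Fin nE} (hj : j ∈ N.Inc i) {W : Set ℝ} (hW : W ∈ 𝓝 (N.endParam i j))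
    (h : ∀ t ∈ Icc 0 (N.len j), t ∈ W → g (N.param j t) = g (N.pos i) -
      |N.arc η j t - N.arc η j (N.endParam i j)|) : j ∈ N.IncMinus g i := by
  have hpos := hη.pos (N.endParam_mem i j)
  refine mem_IncMinus.2 ⟨hj, _, ?_, hasInnerDeriv_of_eventually hη hj (c := -1) hW
    fun t ht htW => by rw [h t ht htW]; ring⟩
  have : 0 < 1 / η j (N.endParam i j) := by positivity
  linarith

variable {p : Fin nE → ℝ}

theorem IsPeak.mem_IncMinus_of_eq (hη : N.IsCapacity η) (hp : N.IsPeak η p) {i : Fin nV}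
    {j : Fin nE} (hj : j ∈ N.Inc i) (h : p j = N.endParam i j) :
    j ∈ N.IncMinus (N.bdist η) i := by
  refine mem_IncMinus_of_eventually hη hj univ_mem fun t ht _ => ?_
  rw [hp.eq j t ht, h, N.param_endParam hj, abs_sub_comm]

theorem IsPeak.mem_IncPlus_of_ne (hη : N.IsCapacity η) (hp : N.IsPeak η p) {i : Fin nV}
    {j : Fin nE} (hj : j ∈ N.Inc i) (h : p j ≠ N.endParam i j) :
    j ∈ N.IncPlus (N.bdist η) i := by
  have hm := (hη.strictMono_arc j).monotone
  have hpm := hp.mem j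
  rcases N.mem_Inc.1 hj with rfl | rfl
  · rw [endParam_src] at h
    have h0 : 0 < p j := lt_of_le_of_ne hpm.1 h.symm
    refine mem_IncPlus_of_eventually hη hj (W := Iio (p j)) ?_ fun t ht htp => ?_
    · rw [endParam_src]; exact Iio_mem_nhds h0
    · rw [endParam_src, ← N.param_zero, abs_of_nonneg (by linarith [hm ht.1])]
      exact hp.eq_of_le hη (N.zero_mem j) ht.1 (le_of_lt htp)
  · rw [endParam_tgt] at h
    have h0 : p j < N.len j := lt_of_le_of_ne hpm.2 h
    refine mem_IncPlus_of_eventually hη hj (W := Ioi (p j)) ?_ fun t ht htp => ?_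
    · rw [endParam_tgt]; exact Ioi_mem_nhds h0
    · rw [endParam_tgt, ← N.param_len, abs_sub_comm, abs_of_nonneg (by linarith [hm ht.2])]
      exact hp.eq_of_ge hη (N.len_mem j) ht.2 (le_of_lt htp)

theorem IsPeak.mem_IncMinus_iff (hη : N.IsCapacity η) (hp : N.IsPeak η p) {i : Fin nV}
    {j : Fin nE} : j ∈ N.IncMinus (N.bdist η) i ↔ j ∈ N.Inc i ∧ p j = N.endParam i j := by
  refine ⟨fun h => ?_, fun h => hp.mem_IncMinus_of_eq hη h.1 h.2⟩
  have hj := (mem_IncMinus.1 h).1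
  refine ⟨hj, ?_⟩
  by_contra hne
  exact notMem_IncMinus_of_mem_IncPlus (hp.mem_IncPlus_of_ne hη hj hne) h

theorem IsPeak.mem_IncPlus_iff (hη : N.IsCapacity η) (hp : N.IsPeak η p) {i : Fin nV}
    {j : Fin nE} : j ∈ N.IncPlus (N.bdist η) i ↔ j ∈ N.Inc i ∧ p j ≠ N.endParam i j := by
  refine ⟨fun h => ?_, fun h => hp.mem_IncPlus_of_ne hη h.1 h.2⟩
  have hj := (mem_IncPlus.1 h).1
  refine ⟨hj, fun he => ?_⟩
  exact notMem_IncMinus_of_mem_IncPlus h (hp.mem_IncMinus_of_eq hη hj he)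

theorem IsPeak.bdist_lt (hη : N.IsCapacity η) (hp : N.IsPeak η p) {j : Fin nE} {t : ℝ}
    (ht : t ∈ Icc 0 (N.len j)) (h : p j ≠ t) :
    N.bdist η (N.param j t) < N.bdist η (N.param j (p j)) := by
  rw [hp.eq j t ht]
  have : 0 < |N.arc η j (p j) - N.arc η j t| :=
    abs_pos.2 (sub_ne_zero.2 fun he => h ((hη.strictMono_arc j).injective he))
  linarith

/-! ### The projection onto the singular set -/

theorem IsPeak.hasDerivWithinAt_of_lt (hη : N.IsCapacity η) (hp : N.IsPeak η p) {j : Fin nE}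
    {t : ℝ} (ht : t ∈ Icc 0 (N.len j)) (h : t < p j) :
    HasDerivWithinAt (N.proj (N.bdist η) j) (1 / η j t) (Icc 0 (N.len j)) t := by
  have h1 : HasDerivAt (fun r => N.bdist η (N.pos (N.src j)) + N.arc η j r) (1 / η j t) t :=
    (hη.hasDerivAt_arc ht).const_add _
  refine h1.hasDerivWithinAt.congr_of_eventuallyEq ?_ ?_
  · filter_upwards [self_mem_nhdsWithin, mem_nhdsWithin_of_mem_nhds (Iio_mem_nhds h)] with r hr hrp
    have := hp.eq_of_le hη (N.zero_mem j) hr.1 (le_of_lt hrp)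
    rwa [arc_zero, sub_zero, N.param_zero] at this
  · have := hp.eq_of_le hη (N.zero_mem j) ht.1 h.le
    rwa [arc_zero, sub_zero, N.param_zero] at this

theorem IsPeak.hasDerivWithinAt_of_gt (hη : N.IsCapacity η) (hp : N.IsPeak η p) {j : Fin nE}
    {t : ℝ} (ht : t ∈ Icc 0 (N.len j)) (h : p j < t) :
    HasDerivWithinAt (N.proj (N.bdist η) j) (-(1 / η j t)) (Icc 0 (N.len j)) t := by
  have h1 : HasDerivAt (fun r => N.bdist η (N.pos (N.tgt j)) + (N.arc η j (N.len j) - N.arc η j r))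
      (-(1 / η j t)) t := ((hη.hasDerivAt_arc ht).const_sub _).const_add _
  refine h1.hasDerivWithinAt.congr_of_eventuallyEq ?_ ?_
  · filter_upwards [self_mem_nhdsWithin, mem_nhdsWithin_of_mem_nhds (Ioi_mem_nhds h)] with r hr hrp
    have := hp.eq_of_ge hη (N.len_mem j) hr.2 (le_of_lt hrp)
    rwa [N.param_len] at this
  · have := hp.eq_of_ge hη (N.len_mem j) ht.2 h.le
    rwa [N.param_len] at this

theorem IsPeak.mem_singParams_iff (hη : N.IsCapacity η) (hp : N.IsPeak η p) {j : Fin nE} {t : ℝ} :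
    t ∈ N.singParams (N.bdist η) j ↔ t ∈ Ioo 0 (N.len j) ∧ t = p j := by
  constructor
  · rintro ⟨ht, hnd⟩
    refine ⟨ht, ?_⟩
    have hn := Icc_mem_nhds ht.1 ht.2
    by_contra hne
    rcases lt_or_gt_of_ne hne with h | h
    · exact hnd ((hp.hasDerivWithinAt_of_lt hη (Ioo_subset_Icc_self ht) h).hasDerivAt
        hn).differentiableAt
    · exact hnd ((hp.hasDerivWithinAt_of_gt hη (Ioo_subset_Icc_self ht) h).hasDerivAt
        hn).differentiableAt
  · rintro ⟨ht, rfl⟩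
    refine ⟨ht, fun hd => ?_⟩
    have hd' := hd.hasDerivAt
    have hpos := hη.pos (Ioo_subset_Icc_self ht)
    have h1 : HasDerivWithinAt (N.proj (N.bdist η) j) (1 / η j (p j)) (Icc 0 (p j)) (p j) := by
      refine (((hη.hasDerivAt_arc (Ioo_subset_Icc_self ht)).const_add
        (N.bdist η (N.param j 0))).hasDerivWithinAt).congr (fun r hr => ?_) ?_
      · have := hp.eq_of_le hη (N.zero_mem j) hr.1 hr.2
        rwa [arc_zero, sub_zero] at this
      · have := hp.eq_of_le hη (N.zero_mem j) ht.1.le le_rfl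
        rwa [arc_zero, sub_zero] at this
    have h2 : HasDerivWithinAt (N.proj (N.bdist η) j) (-(1 / η j (p j))) (Icc (p j) (N.len j))
        (p j) := by
      refine ((((hη.hasDerivAt_arc (Ioo_subset_Icc_self ht)).const_sub
        (N.arc η j (N.len j))).const_add
        (N.bdist η (N.param j (N.len j)))).hasDerivWithinAt).congr (fun r hr => ?_) ?_
      · exact hp.eq_of_ge hη (N.len_mem j) hr.2 hr.1
      · exact hp.eq_of_ge hη (N.len_mem j) ht.2.le le_rfl
    have e1 := UniqueDiffWithinAt.eq_deriv _ (uniqueDiffOn_Icc ht.1 _ (right_mem_Icc.2 ht.1.le))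
      hd'.hasDerivWithinAt h1
    have e2 := UniqueDiffWithinAt.eq_deriv _ (uniqueDiffOn_Icc ht.2 _ (left_mem_Icc.2 ht.2.le))
      hd'.hasDerivWithinAt h2
    have : 0 < 1 / η j (p j) := by positivity
    linarith

theorem IsPeak.projSet_eq (hη : N.IsCapacity η) (hp : N.IsPeak η p) (j : Fin nE) :
    N.projSet η j = {p j} := by
  ext t
  rw [projSet, mem_union, hp.mem_singParams_iff hη, mem_singleton_iff]
  constructor
  · rintro (h | ⟨i, hi, rfl⟩)
    · exact h.2
    · exact ((hp.mem_IncMinus_iff hη).1 hi).2.symm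
  · rintro rfl
    by_cases h : p j ∈ Ioo 0 (N.len j)
    · exact Or.inl ⟨h, rfl⟩
    · right
      rcases eq_or_lt_of_le (hp.mem j).1 with h0 | h0
      · have : p j = N.endParam (N.src j) j := by rw [endParam_src, ← h0]
        exact ⟨_, (hp.mem_IncMinus_iff hη).2 ⟨N.src_mem_Inc j, this⟩, this⟩
      rcases eq_or_lt_of_le (hp.mem j).2 with h1 | h1
      · have : p j = N.endParam (N.tgt j) j := by rw [endParam_tgt, ← h1]
        exact ⟨_, (hp.mem_IncMinus_iff hη).2 ⟨N.tgt_mem_Inc j, this⟩, this⟩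
      exact (h ⟨h0, h1⟩).elim

theorem IsPeak.dirn_of_lt (hη : N.IsCapacity η) (hp : N.IsPeak η p) {j : Fin nE}
    {t : ℝ} (ht : t ∈ Icc 0 (N.len j)) (h : t < p j) : N.dirn η j t = 1 := by
  rw [dirn, (hp.hasDerivWithinAt_of_lt hη ht h).derivWithin
    (uniqueDiffOn_Icc (N.len_pos j) t ht)]
  field_simp [(hη.pos ht).ne']

theorem IsPeak.dirn_of_gt (hη : N.IsCapacity η) (hp : N.IsPeak η p) {j : Fin nE}
    {t : ℝ} (ht : t ∈ Icc 0 (N.len j)) (h : p j < t) : N.dirn η j t = -1 := by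
  rw [dirn, (hp.hasDerivWithinAt_of_gt hη ht h).derivWithin
    (uniqueDiffOn_Icc (N.len_pos j) t ht)]
  field_simp [(hη.pos ht).ne']

theorem IsPeak.tau_eq (hη : N.IsCapacity η) (hp : N.IsPeak η p) {j : Fin nE}
    {t : ℝ} (ht : t ∈ Icc 0 (N.len j)) : N.tau η j t = |p j - t| := by
  rw [tau, hp.projSet_eq hη]
  rcases lt_trichotomy t (p j) with h | h | h
  · rw [hp.dirn_of_lt hη ht h, abs_of_pos (by linarith)]
    convert! csInf_singleton (p j - t)
    ext s
    simp only [mem_ofPred_eq, mem_singleton_iff]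
    constructor
    · rintro ⟨-, h2⟩; linarith
    · rintro rfl; constructor <;> linarith
  · subst h
    rw [sub_self, abs_zero]
    apply IsLeast.csInf_eq
    exact ⟨⟨le_rfl, by simp⟩, fun s hs => hs.1⟩
  · rw [hp.dirn_of_gt hη ht h, abs_of_neg (by linarith)]
    convert! csInf_singleton (-(p j - t))
    ext s
    simp only [mem_ofPred_eq, mem_singleton_iff]
    constructor
    · rintro ⟨-, h2⟩; linarith
    · rintro rfl; constructor <;> linarith

theorem IsPeak.projParam_eq (hη : N.IsCapacity η) (hp : N.IsPeak η p) {j : Fin nE}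
    {t : ℝ} (ht : t ∈ Icc 0 (N.len j)) : N.projParam η j t = p j := by
  rw [projParam, hp.tau_eq hη ht]
  rcases lt_trichotomy t (p j) with h | h | h
  · rw [hp.dirn_of_lt hη ht h, abs_of_pos (by linarith)]; ring
  · subst h; simp
  · rw [hp.dirn_of_gt hη ht h, abs_of_neg (by linarith)]; ring

theorem IsPeak.integral_tau_eq (hη : N.IsCapacity η) (hp : N.IsPeak η p) {j : Fin nE}
    {t : ℝ} (ht : t ∈ Icc 0 (N.len j)) (f : ℝ → ℝ) :
    ∫ r in (0 : ℝ)..N.tau η j t, f (t + r * N.dirn η j t) =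
      if t ≤ p j then ∫ r in t..p j, f r else ∫ r in p j..t, f r := by
  rw [hp.tau_eq hη ht]
  rcases lt_trichotomy t (p j) with h | h | h
  · rw [hp.dirn_of_lt hη ht h, abs_of_pos (by linarith), if_pos h.le]
    simp only [mul_one]
    rw [intervalIntegral.integral_comp_add_left]
    simp
  · subst h; simp
  · rw [hp.dirn_of_gt hη ht h, abs_of_neg (by linarith), if_neg (by linarith)]
    simp only [mul_neg, mul_one, ← sub_eq_add_neg]
    rw [intervalIntegral.integral_comp_sub_left]
    simp

/-! ### The representation formula -/

open Classical in
theorem IsPeak.isRollingFormula_iff (hη : N.IsCapacity η) (hp : N.IsPeak η p)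
    {f : Fin nE → ℝ → ℝ} {C : Fin nV → Finset (Fin nE) → Fin nE → ℝ} {w : Fin nE → ℝ → ℝ} :
    N.IsRollingFormula η f C w ↔ ∀ j, ∀ t ∈ Icc 0 (N.len j),
      w j t = (if t ≤ p j then ∫ r in t..p j, f j r else ∫ r in p j..t, f j r) +
        ∑ i ∈ Finset.univ.filter (fun i => j ∈ N.IncMinus (N.bdist η) i),
          C i (N.IncMinus (N.bdist η) i) j *
            ∑ k ∈ N.IncPlus (N.bdist η) i, w k (N.endParam i k) := by
  refine forall_congr' fun j => forall₂_congr fun t ht => ?_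
  rw [hp.integral_tau_eq hη ht, hp.projParam_eq hη ht]
  have : ∀ i, (j ∈ N.IncMinus (N.bdist η) i ∧ p j = N.endParam i j) ↔
      j ∈ N.IncMinus (N.bdist η) i := fun i =>
    ⟨fun h => h.1, fun h => ⟨h, ((hp.mem_IncMinus_iff hη).1 h).2⟩⟩
  simp only [this]

/-- Recursive systems along a transitive irreflexive relation on a finite type have exactly one
solution. -/
theorem exists_unique_recursive {ι : Type*} [Finite ι] (r : ι → ι → Prop) [IsTrans ι r]
    [Std.Irrefl r] (Φ : (ι → ℝ) → ι → ℝ)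
    (hΦ : ∀ F F' i, (∀ k, r k i → F k = F' k) → Φ F i = Φ F' i) :
    (∃ F, ∀ i, F i = Φ F i) ∧
      ∀ F F' : ι → ℝ, (∀ i, F i = Φ F i) → (∀ i, F' i = Φ F' i) → F = F' := by
  classical
  have wf : WellFounded r := Finite.wellFounded_of_trans_of_irrefl r
  constructor
  · let step : (i : ι) → ((k : ι) → r k i → ℝ) → ℝ := fun i G =>
      Φ (fun k => if h : r k i then G k h else 0) i
    refine ⟨wf.fix step, fun i => ?_⟩
    rw [wf.fix_eq]
    apply hΦ
    intro k hk
    simp [hk]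
  · intro F F' hF hF'
    funext i
    induction i using wf.induction with
    | _ i ih => rw [hF, hF', hΦ F F' i ih]

theorem IsPeak.bdist_lt_of_IncPlus_IncMinus (hη : N.IsCapacity η) (hp : N.IsPeak η p)
    {i k : Fin nV} {j : Fin nE} (hi : j ∈ N.IncPlus (N.bdist η) i)
    (hk : j ∈ N.IncMinus (N.bdist η) k) :
    N.bdist η (N.pos i) < N.bdist η (N.pos k) := by
  rw [hp.mem_IncPlus_iff hη] at hi
  rw [hp.mem_IncMinus_iff hη] at hk
  have := hp.bdist_lt hη (N.endParam_mem i j) hi.2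
  rwa [N.param_endParam hi.1, hk.2, N.param_endParam hk.1] at this

/-- The representation formula has exactly one solution. -/
theorem IsPeak.exists_unique_rollingFormula (hη : N.IsCapacity η) (hp : N.IsPeak η p)
    (f : Fin nE → ℝ → ℝ) (C : Fin nV → Finset (Fin nE) → Fin nE → ℝ) :
    (∃ w, N.IsRollingFormula η f C w) ∧ ∀ w w', N.IsRollingFormula η f C w →
      N.IsRollingFormula η f C w' → ∀ j, EqOn (w j) (w' j) (Icc 0 (N.len j)) := by
  classical
  let r : Fin nV → Fin nV → Prop := fun k i => N.bdist η (N.pos i) < N.bdist η (N.pos k)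
  have : IsTrans (Fin nV) r := ⟨fun _ _ _ h1 h2 => lt_trans h2 h1⟩
  have : Std.Irrefl r := ⟨fun _ h => lt_irrefl _ h⟩
  let I : Fin nE → ℝ → ℝ := fun j t =>
    if t ≤ p j then ∫ r in t..p j, f j r else ∫ r in p j..t, f j r
  let R : (Fin nV → ℝ) → Fin nE → ℝ := fun F j =>
    ∑ i ∈ Finset.univ.filter (fun i => j ∈ N.IncMinus (N.bdist η) i),
      C i (N.IncMinus (N.bdist η) i) j * F i
  let Φ : (Fin nV → ℝ) → Fin nV → ℝ := fun F i =>
    ∑ k ∈ N.IncPlus (N.bdist η) i, (I k (N.endParam i k) + R F k)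
  have hΦ : ∀ F F' i, (∀ k, r k i → F k = F' k) → Φ F i = Φ F' i := by
    intro F F' i h
    refine Finset.sum_congr rfl fun k hk => ?_
    congr 1
    refine Finset.sum_congr rfl fun i' hi' => ?_
    rw [h i' (hp.bdist_lt_of_IncPlus_IncMinus hη hk (Finset.mem_filter.1 hi').2)]
  obtain ⟨⟨F, hF⟩, huniq⟩ := exists_unique_recursive r Φ hΦ
  constructor
  · refine ⟨fun j t => I j t + R F j, (hp.isRollingFormula_iff hη).2 fun j t _ => ?_⟩
    have : ∀ i, ∑ k ∈ N.IncPlus (N.bdist η) i, (I k (N.endParam i k) + R F k) = F i :=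
      fun i => (hF i).symm
    simp only [this]
    rfl
  · have key : ∀ w, N.IsRollingFormula η f C w → ∀ i,
        (fun i => ∑ k ∈ N.IncPlus (N.bdist η) i, w k (N.endParam i k)) i =
          Φ (fun i => ∑ k ∈ N.IncPlus (N.bdist η) i, w k (N.endParam i k)) i := by
      intro w hw i
      refine Finset.sum_congr rfl fun k _ => ?_
      exact (hp.isRollingFormula_iff hη).1 hw k _ (N.endParam_mem i k)
    intro w w' hw hw' j t ht
    have hFF := huniq _ _ (key w hw) (key w' hw')
    rw [(hp.isRollingFormula_iff hη).1 hw j t ht, (hp.isRollingFormula_iff hη).1 hw' j t ht]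
    congr 1
    refine Finset.sum_congr rfl fun i _ => ?_
    rw [show ∑ k ∈ N.IncPlus (N.bdist η) i, w k (N.endParam i k) =
      ∑ k ∈ N.IncPlus (N.bdist η) i, w' k (N.endParam i k) from congrFun hFF i]

end Network

namespace Network

variable {n nV nE : ℕ} {N : Network n nV nE} {η f : Fin nE → ℝ → ℝ}
  {C : Fin nV → Finset (Fin nE) → Fin nE → ℝ} {u : EuclideanSpace ℝ (Fin n) → ℝ}
  {v Du : Fin nE → ℝ → ℝ}

/-! ### Consequences of the weak equation -/

variable (N) in
/-- The weak equation with unknown derivative `Du`. -/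
def WeakEquation (η f v Du : Fin nE → ℝ → ℝ) : Prop :=
  ∀ (ψ : EuclideanSpace ℝ (Fin n) → ℝ) (Dψ : Fin nE → ℝ → ℝ), N.HasDu ψ Dψ →
    (∀ i ∈ N.boundary, ψ (N.pos i) = 0) →
    ∑ j, ∫ t in (0 : ℝ)..N.len j, v j t * η j t * Du j t * Dψ j t =
      ∑ j, ∫ t in (0 : ℝ)..N.len j, f j t * N.proj ψ j t

/-- The weak equation tested with a function given by its values at the vertices and its
derivatives on the edges, after integration by parts. -/
theorem WeakEquation.sum_eq (hw : N.WeakEquation η f v Du)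
    (hf : ∀ j, MemLp (f j) ⊤ (volume.restrict (Ioo 0 (N.len j))))
    (hq : ∀ j, MemLp (fun t => v j t * η j t * Du j t) ⊤ (volume.restrict (Ioo 0 (N.len j))))
    (γ : Fin nV → ℝ) (hγ : ∀ i ∈ N.boundary, γ i = 0) (g : Fin nE → ℝ → ℝ)
    (hg : ∀ j, MemLp (g j) ⊤ (volume.restrict (Ioo 0 (N.len j))))
    (hgγ : ∀ j, γ (N.src j) + ∫ t in (0 : ℝ)..N.len j, g j t = γ (N.tgt j)) :
    ∑ j, ∫ t in (0 : ℝ)..N.len j, (v j t * η j t * Du j t + ∫ s in (0 : ℝ)..t, f j s) * g j t =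
      ∑ j, γ (N.tgt j) * ∫ t in (0 : ℝ)..N.len j, f j t := by
  obtain ⟨ψ, hψv, hψ⟩ := N.exists_proj_eq γ
    (fun j t => γ (N.src j) + ∫ s in (0 : ℝ)..t, g j s) (by simp) hgγ
  have hDu : N.HasDu ψ g := by
    refine ⟨fun j => ?_, fun j => ?_⟩
    · exact (continuousOn_const.add ((hg j).continuousOn_primitive (N.len_pos j).le)).congr (hψ j)
    · exact (hasSobolevDeriv_primitive (N.len_pos j) (hg j) _).congr (hψ j)
  have h := hw ψ g hDu fun i hi => by rw [hψv, hγ i hi]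
  have hqg : ∀ j, IntervalIntegrable (fun t => v j t * η j t * Du j t * g j t) volume 0 (N.len j) :=
    fun j => ((hg j).mul (hq j)).intervalIntegrable_of_top (N.len_pos j).le
  have hF : ∀ j, ContinuousOn (fun t => ∫ s in (0 : ℝ)..t, f j s) (uIcc 0 (N.len j)) := fun j => by
    rw [uIcc_of_le (N.len_pos j).le]
    exact (hf j).continuousOn_primitive (N.len_pos j).le
  have hgi : ∀ j, IntervalIntegrable (g j) volume 0 (N.len j) := fun j =>
    (hg j).intervalIntegrable_of_top (N.len_pos j).le
  have hfi : ∀ j, IntervalIntegrable (f j) volume 0 (N.len j) := fun j =>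
    (hf j).intervalIntegrable_of_top (N.len_pos j).le
  have hFg : ∀ j, IntervalIntegrable (fun t => (∫ s in (0 : ℝ)..t, f j s) * g j t)
      volume 0 (N.len j) := fun j => (hgi j).continuousOn_mul (hF j)
  have e1 : ∀ j, ∫ t in (0 : ℝ)..N.len j,
      (v j t * η j t * Du j t + ∫ s in (0 : ℝ)..t, f j s) * g j t =
      (∫ t in (0 : ℝ)..N.len j, v j t * η j t * Du j t * g j t) +
        ∫ t in (0 : ℝ)..N.len j, (∫ s in (0 : ℝ)..t, f j s) * g j t := fun j => by
    rw [← intervalIntegral.integral_add (hqg j) (hFg j)]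
    simp only [add_mul]
  have e2 : ∀ j, ∫ t in (0 : ℝ)..N.len j, f j t * N.proj ψ j t =
      γ (N.tgt j) * (∫ t in (0 : ℝ)..N.len j, f j t) -
        ∫ t in (0 : ℝ)..N.len j, (∫ s in (0 : ℝ)..t, f j s) * g j t := fun j => by
    have e3 : ∫ t in (0 : ℝ)..N.len j, f j t * N.proj ψ j t =
        ∫ t in (0 : ℝ)..N.len j, (γ (N.src j) * f j t + f j t * ∫ s in (0 : ℝ)..t, g j s) := by
      apply intervalIntegral.integral_congr
      intro t ht
      rw [uIcc_of_le (N.len_pos j).le] at ht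
      simp only
      rw [hψ j ht]
      ring
    have hG : ContinuousOn (fun t => ∫ s in (0 : ℝ)..t, g j s) (uIcc 0 (N.len j)) := by
      rw [uIcc_of_le (N.len_pos j).le]
      exact (hg j).continuousOn_primitive (N.len_pos j).le
    rw [e3, intervalIntegral.integral_add ((hfi j).const_mul _) ((hfi j).mul_continuousOn hG),
      intervalIntegral.integral_const_mul, ← hgγ j]
    have := integral_mul_primitive_add (hfi j) (hgi j)
    linarith
  simp only [e1, Finset.sum_add_distrib]
  rw [h]
  simp only [e2, Finset.sum_sub_distrib]
  ring

/-- The flux `v η Du` is a primitive of `-f`. -/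
theorem WeakEquation.exists_flux (hw : N.WeakEquation η f v Du)
    (hf : ∀ j, MemLp (f j) ⊤ (volume.restrict (Ioo 0 (N.len j))))
    (hq : ∀ j, MemLp (fun t => v j t * η j t * Du j t) ⊤ (volume.restrict (Ioo 0 (N.len j))))
    (j : Fin nE) : ∃ c : ℝ, ∀ᵐ t ∂(volume.restrict (Ioo 0 (N.len j))),
      v j t * η j t * Du j t + (∫ s in (0 : ℝ)..t, f j s) = c := by
  classical
  have hl := N.len_pos j
  obtain ⟨k, hk⟩ : ∃ k : ℝ → ℝ,
    k = fun t => v j t * η j t * Du j t + ∫ s in (0 : ℝ)..t, f j s := ⟨_, rfl⟩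
  have hkm : MemLp k ⊤ (volume.restrict (Ioo 0 (N.len j))) := by
    rw [hk]
    exact (hq j).add (memLp_top_of_continuousOn ((hf j).continuousOn_primitive hl.le))
  have hki := hkm.intervalIntegrable_of_top hl.le
  obtain ⟨c, hc⟩ : ∃ c, c = (∫ t in (0 : ℝ)..N.len j, k t) / N.len j := ⟨_, rfl⟩
  have hgm : MemLp (fun t => k t - c) ⊤ (volume.restrict (Ioo 0 (N.len j))) :=
    hkm.sub (memLp_const c)
  have hgi := hgm.intervalIntegrable_of_top hl.le
  have hg0 : ∫ t in (0 : ℝ)..N.len j, (k t - c) = 0 := by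
    rw [intervalIntegral.integral_sub hki (by simp), intervalIntegral.integral_const, hc]
    simp only [sub_zero, smul_eq_mul]
    field_simp
    ring
  have h := hw.sum_eq hf hq 0 (fun _ _ => rfl) (Pi.single j fun t => k t - c)
    (fun i => by
      by_cases hij : i = j
      · subst hij; simpa using hgm
      · rw [Pi.single_eq_of_ne hij]; exact MemLp.zero)
    (fun i => by
      by_cases hij : i = j
      · subst hij; simpa using hg0
      · rw [Pi.single_eq_of_ne hij]; simp)
  rw [Finset.sum_eq_single j (fun i _ hij => by rw [Pi.single_eq_of_ne hij]; simp) (by simp)] at h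
  simp only [Pi.single_eq_same, Pi.zero_apply, zero_mul, Finset.sum_const_zero] at h
  have h' : ∫ t in (0 : ℝ)..N.len j, k t * (k t - c) = 0 := by
    simpa only [hk] using h
  have hkg : IntervalIntegrable (fun t => k t * (k t - c)) volume 0 (N.len j) :=
    (hgm.mul hkm).intervalIntegrable_of_top hl.le
  have hsq : ∫ t in (0 : ℝ)..N.len j, (k t - c) ^ 2 = 0 := by
    have : ∫ t in (0 : ℝ)..N.len j, (k t * (k t - c) - c * (k t - c)) = 0 := by
      rw [intervalIntegral.integral_sub hkg (hgi.const_mul c), h',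
        intervalIntegral.integral_const_mul, hg0]
      ring
    refine (intervalIntegral.integral_congr fun t _ => ?_).trans this
    ring
  refine ⟨c, ?_⟩
  have hsqi : IntegrableOn (fun t => (k t - c) ^ 2) (Ioo 0 (N.len j)) := by
    rw [← intervalIntegrable_iff_integrableOn_Ioo_of_le hl.le]
    simp only [sq]
    exact (hgm.mul hgm).intervalIntegrable_of_top hl.le
  rw [intervalIntegral.integral_of_le hl.le, integral_Ioc_eq_integral_Ioo,
    integral_eq_zero_iff_of_nonneg (fun t => sq_nonneg _) hsqi] at hsq
  filter_upwards [hsq] with t ht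
  simp only [Pi.zero_apply, ne_eq, OfNat.ofNat_ne_zero, not_false_eq_true, pow_eq_zero_iff] at ht
  rw [hk] at ht
  simp only at ht
  linarith

/-- The balance of the fluxes at a transition vertex. -/
theorem WeakEquation.kirchhoff (hw : N.WeakEquation η f v Du)
    (hf : ∀ j, MemLp (f j) ⊤ (volume.restrict (Ioo 0 (N.len j))))
    (hq : ∀ j, MemLp (fun t => v j t * η j t * Du j t) ⊤ (volume.restrict (Ioo 0 (N.len j))))
    {c : Fin nE → ℝ} (hc : ∀ j, ∀ᵐ t ∂(volume.restrict (Ioo 0 (N.len j))),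
      v j t * η j t * Du j t + (∫ s in (0 : ℝ)..t, f j s) = c j)
    {i : Fin nV} (hi : i ∉ N.boundary) :
    ∑ j ∈ N.Inc i, (if N.src j = i then c j else
      -(c j - ∫ s in (0 : ℝ)..N.len j, f j s)) = 0 := by
  classical
  have hm : ∀ j, ((N.len j) * ((Pi.single i (1 : ℝ) : Fin nV → ℝ) (N.tgt j) -
      (Pi.single i (1 : ℝ) : Fin nV → ℝ) (N.src j))) / N.len j =
      (Pi.single i (1 : ℝ) : Fin nV → ℝ) (N.tgt j) -
      (Pi.single i (1 : ℝ) : Fin nV → ℝ) (N.src j) := fun j =>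
    mul_div_cancel_left₀ _ (N.len_pos j).ne'
  have h := hw.sum_eq hf hq (Pi.single i 1)
    (fun k hk => Pi.single_eq_of_ne (by rintro rfl; exact hi hk) _)
    (fun j _ => ((Pi.single i (1 : ℝ) : Fin nV → ℝ) (N.tgt j) -
      (Pi.single i (1 : ℝ) : Fin nV → ℝ) (N.src j)) / N.len j)
    (fun j => memLp_const _)
    (fun j => by
      rw [intervalIntegral.integral_const, smul_eq_mul, sub_zero, ← mul_div_assoc, hm]
      ring)
  have e : ∀ j, ∫ t in (0 : ℝ)..N.len j,
      (v j t * η j t * Du j t + ∫ s in (0 : ℝ)..t, f j s) *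
        (((Pi.single i (1 : ℝ) : Fin nV → ℝ) (N.tgt j) -
          (Pi.single i (1 : ℝ) : Fin nV → ℝ) (N.src j)) / N.len j) =
      c j * ((Pi.single i (1 : ℝ) : Fin nV → ℝ) (N.tgt j) -
          (Pi.single i (1 : ℝ) : Fin nV → ℝ) (N.src j)) := by
    intro j
    rw [intervalIntegral.integral_mul_const]
    have : ∫ t in (0 : ℝ)..N.len j, (v j t * η j t * Du j t + ∫ s in (0 : ℝ)..t, f j s) =
        ∫ t in (0 : ℝ)..N.len j, c j := by
      rw [intervalIntegral.integral_of_le (N.len_pos j).le,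
        intervalIntegral.integral_of_le (N.len_pos j).le, integral_Ioc_eq_integral_Ioo,
        integral_Ioc_eq_integral_Ioo]
      exact integral_congr_ae (hc j)
    rw [this, intervalIntegral.integral_const, smul_eq_mul, sub_zero]
    have := (N.len_pos j).ne'
    field_simp
  simp only [e] at h
  refine Eq.trans ?_ (sub_eq_zero.2 h.symm)
  rw [Inc, Finset.sum_filter, ← Finset.sum_sub_distrib]
  refine Finset.sum_congr rfl fun j _ => ?_
  have hne := N.src_ne_tgt j
  by_cases h1 : N.src j = i
  · have h2 : N.tgt j ≠ i := fun h => hne (h1.trans h.symm)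
    simp [h1, h2]
  · by_cases h2 : N.tgt j = i
    · simp [h1, h2]
    · simp [h1, h2]

/-! ### Consequences of the viscosity inequality -/

theorem HasDu.edgeLipschitz (hη : N.IsCapacity η) (hu : N.HasDu u Du)
    (hb : ∀ j, ∀ᵐ t ∂(volume.restrict (Ioo 0 (N.len j))), η j t * |Du j t| ≤ 1) :
    N.EdgeLipschitz η u := by
  have key : ∀ j, ∀ s ∈ Icc 0 (N.len j), ∀ t ∈ Icc 0 (N.len j), s ≤ t →
      |u (N.param j t) - u (N.param j s)| ≤ N.arc η j t - N.arc η j s := by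
    intro j s hs t ht hst
    have h := (hu.2 j).sub_eq_integral (hu.1 j) hs ht
    rw [proj, proj] at h
    rw [h, ← hη.integral_one_div hs ht]
    refine intervalIntegral.norm_integral_le_of_norm_le (f := Du j) hst ?_
      (hη.intervalIntegrable_one_div hs ht)
    have hb' := hb j
    rw [Measure.restrict_congr_set Ioo_ae_eq_Ioc, ae_restrict_iff' measurableSet_Ioc] at hb'
    filter_upwards [hb'] with r hr hrm
    have hr' : r ∈ Ioc 0 (N.len j) := ⟨hs.1.trans_lt hrm.1, hrm.2.trans ht.2⟩
    rw [Real.norm_eq_abs, le_div_iff₀ (hη.pos (Ioc_subset_Icc_self hr')), mul_comm]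
    exact hr hr'
  intro j s hs t ht
  rcases le_total s t with h | h
  · have h1 := key j s hs t ht h
    have h2 := neg_abs_le (u (N.param j t) - u (N.param j s))
    have h3 := le_abs_self (N.arc η j t - N.arc η j s)
    linarith
  · have h1 := key j t ht s hs h
    have h2 := le_abs_self (u (N.param j s) - u (N.param j t))
    have h3 := neg_abs_le (N.arc η j t - N.arc η j s)
    linarith

theorem exists_isC1_eqOn (j : Fin nE) {φ₀ : ℝ → ℝ} (h : ContDiff ℝ 1 φ₀) :
    ∃ φ, N.IsC1 φ ∧ EqOn (N.proj φ j) φ₀ (Icc 0 (N.len j)) := by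
  classical
  obtain ⟨γ, hγ⟩ : ∃ γ : Fin nV → ℝ, γ = fun i => if i = N.src j then φ₀ 0 else φ₀ (N.len j) :=
    ⟨_, rfl⟩
  obtain ⟨Φ, hΦ⟩ : ∃ Φ : Fin nE → ℝ → ℝ, Φ = fun k t => if k = j then φ₀ t else
    γ (N.src k) + t * ((γ (N.tgt k) - γ (N.src k)) / N.len k) := ⟨_, rfl⟩
  have hΦd : ∀ k, ContDiff ℝ 1 (Φ k) := by
    intro k
    rw [hΦ]
    by_cases hk : k = j
    · simpa [hk] using h
    · simp only [hk, if_false]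
      fun_prop
  obtain ⟨φ, -, hφ⟩ := N.exists_proj_eq γ Φ
    (fun k => by
      by_cases hk : k = j
      · subst hk; simp [hΦ, hγ]
      · simp [hΦ, hk])
    (fun k => by
      by_cases hk : k = j
      · subst hk; simp [hΦ, hγ, (N.src_ne_tgt k).symm]
      · have := (N.len_pos k).ne'
        simp only [hΦ, hk, if_false]
        field_simp
        ring)
  refine ⟨φ, ⟨fun k => ?_, fun k => ?_⟩, ?_⟩
  · exact (hΦd k).continuous.continuousOn.congr (hφ k)
  · exact (hΦd k).contDiffOn.congr (hφ k)
  · have := hφ j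
    simpa [hΦ] using this

/-- Where the rolling layer does not vanish, the standing layer has maximal slope. -/
theorem IsViscositySolutionOn.ae_slope (hη : N.IsCapacity η)
    (hvis : N.IsViscositySolutionOn η u (N.nonzeroSet v)) (hu : N.HasDu u Du)
    (hb : ∀ j, ∀ᵐ t ∂(volume.restrict (Ioo 0 (N.len j))), η j t * |Du j t| ≤ 1)
    {j : Fin nE} {a b : ℝ} (ha : a ∈ Icc 0 (N.len j)) (hab : a ≤ b) (hbm : b ∈ Icc 0 (N.len j))
    (hv : ∀ t ∈ Ioo a b, v j t ≠ 0) :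
    ∀ᵐ t ∂(volume.restrict (Ioo a b)), η j t * |Du j t| = 1 := by
  have hsub : Icc a b ⊆ Icc 0 (N.len j) := Icc_subset_Icc ha.1 hbm.2
  have hsub' : Ioo a b ⊆ Ioo 0 (N.len j) := Ioo_subset_Ioo ha.1 hbm.2
  have hGc := hη.continuous_arc j
  have hGm := hη.strictMono_arc j
  have hlip := hu.edgeLipschitz hη hb
  have hmin : ∀ t₀ ε δ, 0 < ε → ε < 1 → 0 < δ → ∀ t₁ ∈ Ioo a b,
      ¬ IsLocalMin (fun t => N.proj u j t -
        -((1 - ε) * √((N.arc η j t - N.arc η j t₀) ^ 2 + δ ^ 2))) t₁ := by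
    intro t₀ ε δ hε hε1 hδ t₁ ht₁ hloc
    have ht₁' := hsub' ht₁
    have hrad : ∀ t, 0 < (N.arc η j t - N.arc η j t₀) ^ 2 + δ ^ 2 := fun t => by positivity
    obtain ⟨φ₀, hφ₀⟩ : ∃ φ₀ : ℝ → ℝ,
      φ₀ = fun t => -((1 - ε) * √((N.arc η j t - N.arc η j t₀) ^ 2 + δ ^ 2)) := ⟨_, rfl⟩
    have hφ₀C : ContDiff ℝ 1 φ₀ := by
      rw [hφ₀]
      refine (contDiff_const.mul (ContDiff.sqrt ?_ fun t => (hrad t).ne')).neg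
      exact (((hη.contDiff_arc j).sub contDiff_const).pow 2).add contDiff_const
    obtain ⟨φ, hφ, hφe⟩ := exists_isC1_eqOn (N := N) j hφ₀C
    have hnz : N.param j t₁ ∈ N.nonzeroSet v := by
      refine ⟨mem_iUnion.2 ⟨j, t₁, ⟨Ioo_subset_Icc_self ht₁', hv t₁ ht₁⟩, rfl⟩, ?_⟩
      rintro ⟨i, -, hi⟩
      exact N.edge_disjoint_vertices j t₁ ht₁' i hi.symm
    have hlm : IsLocalMinOn (fun x => u x - φ x) N.carrier (N.param j t₁) := by
      refine N.eventually_nhdsWithin_carrier_of_edge ht₁' ?_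
      filter_upwards [hloc, Icc_mem_nhds ht₁'.1 ht₁'.2] with s hs hsm
      have e1 := hφe hsm
      have e2 := hφe (Ioo_subset_Icc_self ht₁')
      rw [proj] at e1 e2
      rw [e1, e2, hφ₀]
      exact hs
    have h := hvis.super j t₁ ht₁' hnz φ hφ hlm
    have hee : N.proj φ j =ᶠ[𝓝 t₁] φ₀ :=
      eventually_of_mem (Icc_mem_nhds ht₁'.1 ht₁'.2) hφe
    have hd : HasDerivAt φ₀ (-((1 - ε) * ((2 * (N.arc η j t₁ - N.arc η j t₀) * (1 / η j t₁)) /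
        (2 * √((N.arc η j t₁ - N.arc η j t₀) ^ 2 + δ ^ 2))))) t₁ := by
      rw [hφ₀]
      have h1 := (((hη.hasDerivAt_arc (Ioo_subset_Icc_self ht₁')).sub_const
        (N.arc η j t₀)).pow 2).add_const (δ ^ 2)
      have h2 := ((h1.sqrt (hrad t₁).ne').const_mul (1 - ε)).fun_neg
      simpa using h2
    rw [hee.deriv_eq, hd.deriv] at h
    have hηp := hη.pos (Ioo_subset_Icc_self ht₁')
    obtain ⟨R, hR⟩ : ∃ R, R = √((N.arc η j t₁ - N.arc η j t₀) ^ 2 + δ ^ 2) := ⟨_, rfl⟩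
    have hR0 : 0 < R := by rw [hR]; exact Real.sqrt_pos.2 (hrad t₁)
    have hRx : |N.arc η j t₁ - N.arc η j t₀| ≤ R := by
      rw [hR]
      exact Real.abs_le_sqrt (by nlinarith [sq_nonneg δ])
    rw [← hR, abs_neg, abs_mul, abs_div, abs_mul, abs_mul, abs_mul, abs_of_pos hR0,
      abs_of_pos (show (0 : ℝ) < 1 / η j t₁ by positivity), abs_of_pos (show 0 < 1 - ε by linarith),
      abs_of_pos (show (0 : ℝ) < 2 by norm_num)] at h
    have h3 : 2 * |N.arc η j t₁ - N.arc η j t₀| * (1 / η j t₁) / (2 * R) ≤ 1 / η j t₁ := by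
      rw [div_le_iff₀ (by positivity)]
      have : (0 : ℝ) < 1 / η j t₁ := by positivity
      nlinarith
    have h4 := mul_le_mul_of_nonneg_left h3 (show 0 ≤ 1 - ε by linarith)
    have h5 : 0 < ε * (1 / η j t₁) := by positivity
    linarith
  have l1 := hlip j a ha b hbm
  have l2 := hlip j b hbm a ha
  have hGab := hGm.monotone hab
  rw [abs_of_nonneg (by linarith)] at l1
  rw [abs_of_nonpos (by linarith)] at l2
  obtain ⟨c, hc, hce⟩ := intermediate_value_Icc hab hGc.continuousOn
    (show (u (N.param j b) - u (N.param j a) + N.arc η j b + N.arc η j a) / 2 ∈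
      Icc (N.arc η j a) (N.arc η j b) by constructor <;> linarith)
  have hcm := hsub hc
  have h := min_le_of_eikonal_supersolution ((hu.1 j).mono hsub) hGc hGm hmin hc
  simp only [proj] at h
  rw [min_eq_left (by linarith)] at h
  have l3 := hlip j c hcm a ha
  have hGac := hGm.monotone hc.1
  have hGcb := hGm.monotone hc.2
  rw [abs_of_nonpos (by linarith)] at l3
  have i1 := (hu.2 j).sub_eq_integral (hu.1 j) ha hcm
  have i2 := (hu.2 j).sub_eq_integral (hu.1 j) hcm hbm
  simp only [proj] at i1 i2
  have hDi := fun s hs t ht => (hu.2 j).2.1.intervalIntegrable_sub (s := s) (t := t) hs ht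
  have hbs : ∀ s t, s ∈ Icc 0 (N.len j) → t ∈ Icc 0 (N.len j) →
      ∀ᵐ r ∂(volume.restrict (Ioo s t)), |Du j r| ≤ 1 / η j r := by
    intro s t hs ht
    filter_upwards [ae_restrict_of_ae_restrict_of_subset (Ioo_subset_Ioo hs.1 ht.2) (hb j),
      ae_restrict_mem measurableSet_Ioo] with r hr hrm
    rw [le_div_iff₀ (hη.pos ⟨hs.1.trans hrm.1.le, hrm.2.le.trans ht.2⟩), mul_comm]
    exact hr
  have a1 := ae_eq_of_le_of_integral_eq hc.1 (hDi a ha c hcm) (hη.intervalIntegrable_one_div ha hcm)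
    (by filter_upwards [hbs a c ha hcm] with r hr; exact (le_abs_self _).trans hr)
    (by rw [← i1, hη.integral_one_div ha hcm]; linarith)
  have a2 := ae_eq_of_le_of_integral_eq (g := fun t => -Du j t) hc.2 (hDi c hcm b hbm).neg
    (hη.intervalIntegrable_one_div hcm hbm)
    (by filter_upwards [hbs c b hcm hbm] with r hr; exact (neg_le_abs _).trans hr)
    (by rw [intervalIntegral.integral_neg, ← i2, hη.integral_one_div hcm hbm]; linarith)
  rw [ae_restrict_iff' measurableSet_Ioo] at a1 a2 ⊢
  have hnc : ∀ᵐ t : ℝ, t ≠ c := by simp [ae_iff]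
  filter_upwards [a1, a2, hnc] with t h1 h2 h3 ht
  have hp := hη.pos (hsub (Ioo_subset_Icc_self ht))
  rcases lt_or_gt_of_ne h3 with h' | h'
  · rw [h1 ⟨ht.1, h'⟩, abs_of_pos (by positivity)]
    field_simp
  · rw [← abs_neg, h2 ⟨h', ht.2⟩, abs_of_pos (by positivity)]
    field_simp

/-! ### The flux of a solution -/

variable (N) in
/-- The flux `Q = v η Du` of a solution, oriented by the parameters of the edges. -/
structure IsFlux (η f : Fin nE → ℝ → ℝ) (u : EuclideanSpace ℝ (Fin n) → ℝ)
    (v Q : Fin nE → ℝ → ℝ) : Prop where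
  sub_eq : ∀ j, ∀ s ∈ Icc 0 (N.len j), ∀ t ∈ Icc 0 (N.len j), Q j s - Q j t = ∫ r in s..t, f j r
  cont : ∀ j, ContinuousOn (Q j) (Icc 0 (N.len j))
  anti : ∀ j, AntitoneOn (Q j) (Icc 0 (N.len j))
  abs_eq : ∀ j, ∀ t ∈ Icc 0 (N.len j), v j t = |Q j t|
  up : ∀ j, ∀ t ∈ Icc 0 (N.len j), 0 < Q j t →
    u (N.param j t) = u (N.pos (N.src j)) + N.arc η j t
  down : ∀ j, ∀ t ∈ Icc 0 (N.len j), Q j t < 0 →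
    u (N.param j t) = u (N.pos (N.tgt j)) + (N.arc η j (N.len j) - N.arc η j t)
  kirchhoff : ∀ i, i ∉ N.boundary →
    ∑ j ∈ N.Inc i, (if N.src j = i then Q j 0 else -Q j (N.len j)) = 0

theorem IsSource.integral_nonneg (hf : N.IsSource f) {j : Fin nE} {s t : ℝ}
    (hs : s ∈ Icc 0 (N.len j)) (ht : t ∈ Icc 0 (N.len j)) (hst : s ≤ t) :
    0 ≤ ∫ r in s..t, f j r := by
  rw [intervalIntegral.integral_of_le hst, integral_Ioc_eq_integral_Ioo]
  exact integral_nonneg_of_ae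
    (ae_restrict_of_ae_restrict_of_subset (Ioo_subset_Ioo hs.1 ht.2) (hf.2.1 j))

theorem IsSolution.exists_isFlux (hη : N.IsCapacity η) (hf : N.IsSource f)
    (h : N.IsSolution η f C u v) : N.EdgeLipschitz η u ∧ ∃ Q, N.IsFlux η f u v Q := by
  obtain ⟨Du, hu, hb, hw⟩ := h.weak
  replace hw : N.WeakEquation η f v Du := hw
  refine ⟨hu.edgeLipschitz hη hb, ?_⟩
  have hq : ∀ j, MemLp (fun t => v j t * η j t * Du j t) ⊤ (volume.restrict (Ioo 0 (N.len j))) :=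
    fun j => (hu.2 j).2.1.mul (memLp_top_of_continuousOn ((h.v_cont j).mul (hη j).1))
  choose c hc using hw.exists_flux hf.1 hq
  obtain ⟨Q, hQ⟩ : ∃ Q : Fin nE → ℝ → ℝ, Q = fun j t => c j - ∫ s in (0 : ℝ)..t, f j s := ⟨_, rfl⟩
  have hQae : ∀ j, ∀ᵐ t ∂(volume.restrict (Ioo 0 (N.len j))), v j t * η j t * Du j t = Q j t := by
    intro j
    filter_upwards [hc j] with t ht
    rw [hQ]
    simp only
    linarith
  have hsub : ∀ j, ∀ s ∈ Icc 0 (N.len j), ∀ t ∈ Icc 0 (N.len j),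
      Q j s - Q j t = ∫ r in s..t, f j r := by
    intro j s hs t ht
    rw [← intervalIntegral.integral_interval_sub_left
      ((hf.1 j).intervalIntegrable_sub (N.zero_mem j) ht)
      ((hf.1 j).intervalIntegrable_sub (N.zero_mem j) hs), hQ]
    ring
  have hcont : ∀ j, ContinuousOn (Q j) (Icc 0 (N.len j)) := by
    intro j
    rw [hQ]
    exact continuousOn_const.sub ((hf.1 j).continuousOn_primitive (N.len_pos j).le)
  have hanti : ∀ j, AntitoneOn (Q j) (Icc 0 (N.len j)) := by
    intro j s hs t ht hst
    have := hsub j s hs t ht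
    have := hf.integral_nonneg hs ht hst
    linarith
  have hle : ∀ j, ∀ t ∈ Icc 0 (N.len j), |Q j t| ≤ v j t := by
    intro j
    have : EqOn (fun t => max |Q j t| (v j t)) (v j) (Icc 0 (N.len j)) := by
      apply Measure.eqOn_Icc_of_ae_eq volume (N.len_pos j).ne _ (ContinuousOn.sup (hcont j).abs (h.v_cont j))
        (h.v_cont j)
      rw [Filter.EventuallyEq, ← restrict_Ioo_eq_restrict_Icc]
      filter_upwards [hQae j, hb j, ae_restrict_mem measurableSet_Ioo] with t h1 h2 h3
      have h3' := Ioo_subset_Icc_self h3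
      have hv := h.v_nonneg j t h3'
      apply max_eq_right
      rw [← h1, abs_mul, abs_mul, abs_of_nonneg hv, abs_of_pos (hη.pos h3'), mul_assoc]
      nlinarith
    intro t ht
    have := this ht
    simp only at this
    rw [← this]
    exact le_max_left _ _
  have habsIoo : ∀ j, ∀ t ∈ Ioo 0 (N.len j), v j t = |Q j t| := by
    intro j t ht
    have ht' := Ioo_subset_Icc_self ht
    by_cases hvt : v j t = 0
    · have := hle j t ht'
      rw [hvt] at this ⊢
      exact (le_antisymm this (abs_nonneg _)).symm
    · have hca : ContinuousAt (v j) t := (h.v_cont j).continuousAt (Icc_mem_nhds ht.1 ht.2)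
      have hev : ∀ᶠ s in 𝓝 t, s ∈ Ioo 0 (N.len j) ∧ v j s ≠ 0 :=
        Filter.Eventually.and (Ioo_mem_nhds ht.1 ht.2) (hca.eventually_ne hvt)
      obtain ⟨a, b, htab, hab⟩ := (mem_nhds_iff_exists_Ioo_subset).1 hev
      obtain ⟨a', ha1, ha2⟩ := exists_between htab.1
      obtain ⟨b', hb1, hb2⟩ := exists_between htab.2
      have hIcc : Icc a' b' ⊆ {s | s ∈ Ioo 0 (N.len j) ∧ v j s ≠ 0} := fun s hs =>
        hab ⟨ha1.trans_le hs.1, hs.2.trans_lt hb2⟩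
      have hab' : a' ≤ b' := (ha2.trans hb1).le
      have hslope := h.viscosity.ae_slope hη hu hb
        (Ioo_subset_Icc_self (hIcc (left_mem_Icc.2 hab')).1) hab'
        (Ioo_subset_Icc_self (hIcc (right_mem_Icc.2 hab')).1)
        (fun s hs => (hIcc (Ioo_subset_Icc_self hs)).2)
      have hsubset : Ioo a' b' ⊆ Ioo 0 (N.len j) := fun s hs => (hIcc (Ioo_subset_Icc_self hs)).1
      have heq : EqOn (v j) (fun s => |Q j s|) (Ioo a' b') := by
        apply Measure.eqOn_open_of_ae_eq (μ := volume) _ isOpen_Ioo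
          ((h.v_cont j).mono (hsubset.trans Ioo_subset_Icc_self))
          ((hcont j).abs.mono (hsubset.trans Ioo_subset_Icc_self))
        filter_upwards [hslope, ae_restrict_of_ae_restrict_of_subset hsubset (hQae j),
          ae_restrict_mem measurableSet_Ioo] with s h1 h2 h3
        have h3' := Ioo_subset_Icc_self (hsubset h3)
        rw [← h2, abs_mul, abs_mul, abs_of_nonneg (h.v_nonneg j s h3'), abs_of_pos (hη.pos h3'),
          mul_assoc, h1, mul_one]
      exact heq ⟨ha2, hb1⟩
  have habs : ∀ j, ∀ t ∈ Icc 0 (N.len j), v j t = |Q j t| := by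
    intro j
    have : EqOn (v j) (fun t => |Q j t|) (Icc 0 (N.len j)) := by
      apply Measure.eqOn_Icc_of_ae_eq volume (N.len_pos j).ne _ (h.v_cont j) (hcont j).abs
      rw [Filter.EventuallyEq, ← restrict_Ioo_eq_restrict_Icc]
      filter_upwards [ae_restrict_mem measurableSet_Ioo] with t ht
      exact habsIoo j t ht
    exact this
  refine ⟨Q, hsub, hcont, hanti, habs, ?_, ?_, ?_⟩
  · intro j t ht hpos
    have e := (hu.2 j).sub_eq_integral (hu.1 j) (N.zero_mem j) ht
    have : ∫ r in (0 : ℝ)..t, Du j r = ∫ r in (0 : ℝ)..t, 1 / η j r := by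
      rw [intervalIntegral.integral_of_le ht.1, intervalIntegral.integral_of_le ht.1,
        integral_Ioc_eq_integral_Ioo, integral_Ioc_eq_integral_Ioo]
      apply integral_congr_ae
      filter_upwards [ae_restrict_of_ae_restrict_of_subset
        (Ioo_subset_Ioo le_rfl ht.2) (hQae j), ae_restrict_mem measurableSet_Ioo] with s h1 h2
      have hs : s ∈ Icc 0 (N.len j) := ⟨h2.1.le, h2.2.le.trans ht.2⟩
      have hQs : 0 < Q j s := hpos.trans_le (hanti j hs ht h2.2.le)
      have hηs := hη.pos hs
      rw [habs j s hs, abs_of_pos hQs, mul_assoc] at h1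
      rw [eq_div_iff hηs.ne', mul_comm]
      exact mul_left_cancel₀ hQs.ne' (h1.trans (mul_one _).symm)
    rw [this, hη.integral_one_div (N.zero_mem j) ht, arc_zero, proj, proj, N.param_zero] at e
    linarith
  · intro j t ht hneg
    have e := (hu.2 j).sub_eq_integral (hu.1 j) ht (N.len_mem j)
    have : ∫ r in t..N.len j, Du j r = ∫ r in t..N.len j, -(1 / η j r) := by
      rw [intervalIntegral.integral_of_le ht.2, intervalIntegral.integral_of_le ht.2,
        integral_Ioc_eq_integral_Ioo, integral_Ioc_eq_integral_Ioo]
      apply integral_congr_ae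
      filter_upwards [ae_restrict_of_ae_restrict_of_subset
        (Ioo_subset_Ioo ht.1 le_rfl) (hQae j), ae_restrict_mem measurableSet_Ioo] with s h1 h2
      have hs : s ∈ Icc 0 (N.len j) := ⟨ht.1.trans h2.1.le, h2.2.le⟩
      have hQs : Q j s < 0 := (hanti j ht hs h2.1.le).trans_lt hneg
      have hηs := hη.pos hs
      rw [habs j s hs, abs_of_neg hQs, mul_assoc] at h1
      rw [← neg_div, eq_div_iff hηs.ne', mul_comm]
      exact mul_left_cancel₀ (neg_ne_zero.2 hQs.ne) (h1.trans (by ring))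
    rw [this, intervalIntegral.integral_neg, hη.integral_one_div ht (N.len_mem j), proj, proj,
      N.param_len] at e
    linarith
  · intro i hi
    refine Eq.trans ?_ (hw.kirchhoff hf.1 hq hc hi)
    refine Finset.sum_congr rfl fun j _ => ?_
    rw [hQ]
    simp

end Network

namespace Network

variable {n nV nE : ℕ} {N : Network n nV nE} {η f : Fin nE → ℝ → ℝ}
  {C : Fin nV → Finset (Fin nE) → Fin nE → ℝ} {u : EuclideanSpace ℝ (Fin n) → ℝ}
  {v Q : Fin nE → ℝ → ℝ} {p : Fin nE → ℝ}

/-! ### Uphill paths -/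

variable (N) in
/-- Some point of `S` is reached from `x` by a path along which the distance from the boundary
grows as fast as possible. -/
def ReachesUphill (η : Fin nE → ℝ → ℝ) (S : Set (EuclideanSpace ℝ (Fin n)))
    (x : EuclideanSpace ℝ (Fin n)) : Prop :=
  ∃ y ∈ S, ∃ L, N.IsPathLength η x y L ∧ N.bdist η y = N.bdist η x + L

theorem IsPeak.reachesUphill_of_edge (hη : N.IsCapacity η) (hp : N.IsPeak η p)
    {S : Set (EuclideanSpace ℝ (Fin n))} {j : Fin nE} {t r : ℝ} (ht : t ∈ Icc 0 (N.len j))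
    (hr : r ∈ uIcc t (p j)) (hS : N.param j r ∈ S) : N.ReachesUphill η S (N.param j t) := by
  have hrm := uIcc_subset_Icc ht (hp.mem j) hr
  refine ⟨_, hS, _, .single j t r ht hrm, ?_⟩
  rw [hη.subEdgeLength_eq ht hrm]
  have hm := (hη.strictMono_arc j).monotone
  rcases mem_uIcc.1 hr with h | h
  · rw [abs_of_nonneg (by linarith [hm h.1])]
    exact hp.eq_of_le hη ht h.1 h.2
  · rw [abs_of_nonpos (by linarith [hm h.2]), hp.eq_of_ge hη ht h.2 h.1]
    ring

theorem IsPeak.reachesUphill_of_vertex (hη : N.IsCapacity η) (hp : N.IsPeak η p)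
    {S : Set (EuclideanSpace ℝ (Fin n))} {j : Fin nE} {t : ℝ} (ht : t ∈ Icc 0 (N.len j))
    {i : Fin nV} (hj : j ∈ N.IncMinus (N.bdist η) i) (hS : N.ReachesUphill η S (N.pos i)) :
    N.ReachesUphill η S (N.param j t) := by
  obtain ⟨y, hy, L, hL, hd⟩ := hS
  obtain ⟨hj', hpe⟩ := (hp.mem_IncMinus_iff hη).1 hj
  refine ⟨y, hy, _, .cons j t ht i hj' y L hL, ?_⟩
  have := hp.eq j t ht
  rw [hpe, N.param_endParam hj'] at this
  rw [hη.subEdgeLength_eq ht (N.endParam_mem i j)]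
  linarith

/-- The peak of an edge is an interior point, or a vertex from which the edge goes downhill. -/
theorem IsPeak.interior_or_vertex (hη : N.IsCapacity η) (hp : N.IsPeak η p) (j : Fin nE) :
    p j ∈ Ioo 0 (N.len j) ∨ ∃ i, j ∈ N.IncMinus (N.bdist η) i := by
  have : p j ∈ N.projSet η j := by rw [hp.projSet_eq hη]; rfl
  rcases this with h | ⟨i, hi, -⟩
  · exact Or.inl h.1
  · exact Or.inr ⟨i, hi⟩

theorem IsPeak.notMem_boundary (hη : N.IsCapacity η) (hp : N.IsPeak η p) {i : Fin nV} {j : Fin nE}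
    (hj : j ∈ N.IncMinus (N.bdist η) i) : i ∉ N.boundary := by
  intro hi
  obtain ⟨hj', hpe⟩ := (hp.mem_IncMinus_iff hη).1 hj
  obtain ⟨t, ht, hne⟩ : ∃ t ∈ Icc 0 (N.len j), p j ≠ t := by
    by_cases h : p j = 0
    · exact ⟨_, N.len_mem j, h ▸ (N.len_pos j).ne⟩
    · exact ⟨0, N.zero_mem j, h⟩
  have h1 := hp.bdist_lt hη ht hne
  rw [hpe, N.param_endParam hj', bdist_boundary ⟨j⟩ hi] at h1
  exact absurd (bdist_nonneg _) h1.not_ge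

/-- Every point is joined by an uphill path to the singular set. -/
theorem IsPeak.reachesUphill_singularSet (hη : N.IsCapacity η) (hp : N.IsPeak η p)
    {j : Fin nE} {t : ℝ} (ht : t ∈ Icc 0 (N.len j)) :
    N.ReachesUphill η (N.singularSet η) (N.param j t) := by
  have hedge : ∀ j t, t ∈ Icc 0 (N.len j) → p j ∈ Ioo 0 (N.len j) →
      N.ReachesUphill η (N.singularSet η) (N.param j t) := fun j t ht hpj =>
    hp.reachesUphill_of_edge hη ht right_mem_uIcc
      (Or.inl (mem_iUnion.2 ⟨j, p j, (hp.mem_singParams_iff hη).2 ⟨hpj, rfl⟩, rfl⟩))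
  have hvert : ∀ i, N.ReachesUphill η (N.singularSet η) (N.pos i) := by
    let r : Fin nV → Fin nV → Prop := fun k i => N.bdist η (N.pos i) < N.bdist η (N.pos k)
    have : IsTrans (Fin nV) r := ⟨fun _ _ _ h1 h2 => lt_trans h2 h1⟩
    have : Std.Irrefl r := ⟨fun _ h => lt_irrefl _ h⟩
    intro i
    induction i using (Finite.wellFounded_of_trans_of_irrefl r).induction with
    | _ i ih =>
    by_cases hne : ∃ k, k ∈ N.IncPlus (N.bdist η) i
    · obtain ⟨k, hk⟩ := hne
      rw [← N.param_endParam (mem_IncPlus.1 hk).1]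
      rcases hp.interior_or_vertex hη k with h | ⟨i', hi'⟩
      · exact hedge k _ (N.endParam_mem i k) h
      · exact hp.reachesUphill_of_vertex hη (N.endParam_mem i k) hi'
          (ih i' (hp.bdist_lt_of_IncPlus_IncMinus hη hk hi'))
    · refine ⟨N.pos i, Or.inr ⟨i, rfl, ?_⟩, 0, isPathLength_pos_refl ⟨j⟩ i, (add_zero _).symm⟩
      refine N.eventually_nhdsWithin_carrier_of_vertex le_rfl fun k hk s hs => ?_
      have hpk : p k = N.endParam i k := by
        by_contra h
        exact hne ⟨k, hp.mem_IncPlus_of_ne hη hk h⟩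
      rw [hp.eq k s hs, hpk, N.param_endParam hk]
      linarith [abs_nonneg (N.arc η k (N.endParam i k) - N.arc η k s)]
  rcases hp.interior_or_vertex hη j with h | ⟨i, hi⟩
  · exact hedge j t ht h
  · exact hp.reachesUphill_of_vertex hη ht hi (hvert i)

theorem EdgeLipschitz.eq_bdist_of_reachesUphill (hη : N.IsCapacity η) (hlip : N.EdgeLipschitz η u)
    (hb : ∀ i ∈ N.boundary, u (N.pos i) = 0) {S : Set (EuclideanSpace ℝ (Fin n))}
    (hS : ∀ y ∈ S, u y = N.bdist η y) {j : Fin nE} {t : ℝ} (ht : t ∈ Icc 0 (N.len j))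
    (h : N.ReachesUphill η S (N.param j t)) : u (N.param j t) = N.bdist η (N.param j t) := by
  obtain ⟨y, hy, L, hL, hd⟩ := h
  have hneg : N.EdgeLipschitz η fun x => -u x := fun j s hs t ht => by
    have := hlip j t ht s hs
    rw [abs_sub_comm] at this
    linarith
  have h1 := hneg.le_add_of_isPathLength hη hL
  have h2 := hlip.le_bdist hη hb ht
  have h3 := hS y hy
  linarith

theorem IsPeak.bdist_eq_minimalProfile (hη : N.IsCapacity η) (hp : N.IsPeak η p)
    {j : Fin nE} {t : ℝ} (ht : t ∈ Icc 0 (N.len j))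
    (h : N.ReachesUphill η (N.sourceSupport f) (N.param j t)) :
    N.bdist η (N.param j t) = N.minimalProfile η f (N.param j t) := by
  have hneg : N.EdgeLipschitz η fun x => -N.bdist η x := fun j s hs t ht => by
    have := hp.edgeLipschitz j t ht s hs
    rw [abs_sub_comm] at this
    linarith
  have hub : ∀ y ∈ N.sourceSupport f,
      max (N.bdist η y - N.wdist η (N.param j t) y) 0 ≤ N.bdist η (N.param j t) := by
    intro y hy
    obtain ⟨k, s, hs, rfl⟩ := mem_iUnion.1 hy
    refine max_le ?_ (bdist_nonneg _)
    rw [sub_le_comm]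
    refine le_csInf (exists_isPathLength_param ht hs.1) fun L hL => ?_
    have := hneg.le_add_of_isPathLength hη hL
    linarith
  obtain ⟨y, hy, L, hL, hd⟩ := h
  refine le_antisymm ?_ (csSup_le ⟨_, y, hy, rfl⟩ ?_)
  · refine le_csSup_of_le ⟨N.bdist η (N.param j t), ?_⟩ ⟨y, hy, rfl⟩ ?_
    · rintro _ ⟨z, hz, rfl⟩
      exact hub z hz
    · refine le_max_of_le_left ?_
      have := hL.wdist_le
      linarith
  · rintro _ ⟨z, hz, rfl⟩
    exact hub z hz

/-! ### The support of the source -/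

theorem exists_mem_essSupport {l : ℝ} {g : ℝ → ℝ} {s t : ℝ} (hs : s ∈ Icc 0 l) (ht : t ∈ Icc 0 l)
    (h : ∫ r in s..t, g r ≠ 0) : ∃ r ∈ uIcc s t, r ∈ essSupport l g := by
  by_contra! hcon
  apply h
  have hnull : volume (uIcc s t ∩ {r ∈ Ioo 0 l | g r ≠ 0}) = 0 := by
    apply measure_null_of_locally_null
    intro r hr
    have h1 := hcon r hr.1
    have h2 : ∃ U ∈ 𝓝 r, volume (U ∩ {s ∈ Ioo 0 l | g s ≠ 0}) = 0 := by
      by_contra! h2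
      exact h1 ⟨Ioo_subset_Icc_self hr.2.1, fun U hU => pos_iff_ne_zero.2 (h2 U hU)⟩
    obtain ⟨U, hU, hU0⟩ := h2
    refine ⟨U ∩ {s ∈ Ioo 0 l | g s ≠ 0}, ?_, hU0⟩
    refine inter_mem (mem_nhdsWithin_of_mem_nhds hU) ?_
    exact mem_of_superset self_mem_nhdsWithin inter_subset_right
  have hz : ∀ᵐ r, r ∈ uIoc s t → g r = 0 := by
    have hl : ∀ᵐ r : ℝ, r ≠ l := by simp [ae_iff]
    filter_upwards [measure_eq_zero_iff_ae_notMem.1 hnull, hl] with r hr hrl hrm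
    by_contra hg
    have hrm' := uIcc_subset_Icc hs ht (uIoc_subset_uIcc hrm)
    have hr0 : 0 < r := by
      have := hrm.1
      exact (le_min hs.1 ht.1).trans_lt this
    exact hr ⟨uIoc_subset_uIcc hrm, ⟨hr0, lt_of_le_of_ne hrm'.2 hrl⟩, hg⟩
  rw [intervalIntegral.integral_congr_ae (g := fun _ => 0) hz]
  simp

theorem mem_essSupport_of_frequently {l : ℝ} {g : ℝ → ℝ} {t : ℝ} (ht : t ∈ Icc 0 l)
    (h : ∀ δ > 0, ∃ s ∈ Icc 0 l, |s - t| < δ ∧ ∫ r in s..t, g r ≠ 0) : t ∈ essSupport l g := by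
  refine ⟨ht, fun U hU => ?_⟩
  obtain ⟨δ, hδ, hU'⟩ := Metric.mem_nhds_iff.1 hU
  obtain ⟨s, hs, hst, hint⟩ := h δ hδ
  obtain ⟨r, hr, hre⟩ := exists_mem_essSupport hs ht hint
  refine hre.2 U (mem_of_superset (Metric.isOpen_ball.mem_nhds ?_) hU')
  rw [Metric.mem_ball, Real.dist_eq]
  have : |r - t| ≤ |s - t| := by
    rw [uIcc_comm] at hr
    exact abs_sub_left_of_mem_uIcc hr
  exact this.trans_lt hst

namespace IsFlux

theorem mem_closure_of_mem_essSupport (hQ : N.IsFlux η f u v Q) (hf : N.IsSource f) {j : Fin nE}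
    {t : ℝ} (h : t ∈ essSupport (N.len j) (f j)) :
    t ∈ closure {t ∈ Icc 0 (N.len j) | v j t ≠ 0} := by
  have ht := h.1
  rw [Metric.mem_closure_iff]
  by_contra! hcon
  obtain ⟨δ, hδ, hδ'⟩ := hcon
  have hQ0 : ∀ s ∈ Icc 0 (N.len j), |t - s| < δ → Q j s = 0 := by
    intro s hs hst
    by_contra hne
    have := hδ' s ⟨hs, by rw [hQ.abs_eq j s hs]; exact abs_ne_zero.2 hne⟩
    rw [Real.dist_eq] at this
    linarith
  obtain ⟨a, ha⟩ : ∃ a, a = max (t - δ / 2) 0 := ⟨_, rfl⟩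
  obtain ⟨b, hb⟩ : ∃ b, b = min (t + δ / 2) (N.len j) := ⟨_, rfl⟩
  have hat : a ≤ t := by rw [ha]; exact max_le (by linarith) ht.1
  have htb : t ≤ b := by rw [hb]; exact le_min (by linarith) ht.2
  have ham : a ∈ Icc 0 (N.len j) := ⟨by rw [ha]; exact le_max_right _ _, hat.trans ht.2⟩
  have hbm : b ∈ Icc 0 (N.len j) := ⟨ht.1.trans htb, by rw [hb]; exact min_le_right _ _⟩
  have ha1 : t - δ / 2 ≤ a := by rw [ha]; exact le_max_left _ _
  have hb1 : b ≤ t + δ / 2 := by rw [hb]; exact min_le_left _ _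
  have hint := hQ.sub_eq j a ham b hbm
  rw [hQ0 a ham (by rw [abs_of_nonneg (by linarith)]; linarith),
    hQ0 b hbm (by rw [abs_of_nonpos (by linarith)]; linarith), sub_self,
    intervalIntegral.integral_of_le (hat.trans htb), integral_Ioc_eq_integral_Ioo] at hint
  have hsub : Ioo a b ⊆ Ioo 0 (N.len j) := Ioo_subset_Ioo ham.1 hbm.2
  have hae := (integral_eq_zero_iff_of_nonneg_ae
    (ae_restrict_of_ae_restrict_of_subset hsub (hf.2.1 j))
    (((hf.1 j).integrable (by simp)).mono_measure (Measure.restrict_mono hsub le_rfl))).1 hint.symm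
  have hpos := h.2 (Ioo (t - δ / 2) (t + δ / 2)) (Ioo_mem_nhds (by linarith) (by linarith))
  refine hpos.ne' (measure_eq_zero_iff_ae_notMem.2 ?_)
  rw [Filter.EventuallyEq, ae_restrict_iff' measurableSet_Ioo] at hae
  filter_upwards [hae] with r hr hrm
  refine hrm.2.2 (hr ⟨?_, ?_⟩)
  · rw [ha]; exact max_lt hrm.1.1 hrm.2.1.1
  · rw [hb]; exact lt_min hrm.1.2 hrm.2.1.2

theorem mem_essSupport_of_mem_closure (hQ : N.IsFlux η f u v Q) {j : Fin nE}
    {t : ℝ} (ht : t ∈ Icc 0 (N.len j)) (h : t ∈ closure {t ∈ Icc 0 (N.len j) | v j t ≠ 0})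
    (h0 : Q j t = 0) : t ∈ essSupport (N.len j) (f j) := by
  refine mem_essSupport_of_frequently ht fun δ hδ => ?_
  obtain ⟨s, ⟨hs, hvs⟩, hst⟩ := Metric.mem_closure_iff.1 h δ hδ
  refine ⟨s, hs, ?_, ?_⟩
  · rwa [dist_comm, Real.dist_eq] at hst
  · rw [← hQ.sub_eq j s hs t ht, h0, sub_zero]
    rw [hQ.abs_eq j s hs] at hvs
    exact abs_ne_zero.1 hvs

/-! ### The standing layer where the rolling layer does not vanish -/

variable (N) in
/-- The flux arriving at the `i`-th vertex from the `j`-th edge. -/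
noncomputable def vertexFlux (Q : Fin nE → ℝ → ℝ) (i : Fin nV) (j : Fin nE) : ℝ :=
  if N.src j = i then Q j 0 else -Q j (N.len j)

theorem vertexFlux_src (j : Fin nE) : vertexFlux N Q (N.src j) j = Q j 0 := by simp [vertexFlux]

theorem vertexFlux_tgt (j : Fin nE) : vertexFlux N Q (N.tgt j) j = -Q j (N.len j) := by
  simp [vertexFlux, N.src_ne_tgt]

theorem abs_vertexFlux (hQ : N.IsFlux η f u v Q) (i : Fin nV) (j : Fin nE) :
    v j (N.endParam i j) = |vertexFlux N Q i j| := by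
  rw [hQ.abs_eq j _ (N.endParam_mem i j), endParam, vertexFlux]
  split_ifs <;> simp

theorem v_nonneg (hQ : N.IsFlux η f u v Q) {j : Fin nE} {t : ℝ} (ht : t ∈ Icc 0 (N.len j)) :
    0 ≤ v j t := by
  rw [hQ.abs_eq j t ht]
  exact abs_nonneg _

theorem eq_bdist_vertex (hη : N.IsCapacity η) (hp : N.IsPeak η p) (hlip : N.EdgeLipschitz η u)
    (hb : ∀ i ∈ N.boundary, u (N.pos i) = 0) (hQ : N.IsFlux η f u v Q) {i : Fin nV} {j : Fin nE}
    (hj : j ∈ N.Inc i) (h : vertexFlux N Q i j ≠ 0) : u (N.pos i) = N.bdist η (N.pos i) := by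
  let r : Fin nV → Fin nV → Prop := fun k i => u (N.pos k) < u (N.pos i)
  have : IsTrans (Fin nV) r := ⟨fun _ _ _ h1 h2 => lt_trans h1 h2⟩
  have : Std.Irrefl r := ⟨fun _ h => lt_irrefl _ h⟩
  induction i using (Finite.wellFounded_of_trans_of_irrefl r).induction generalizing j with
  | _ i ih =>
  by_cases hi : i ∈ N.boundary
  · rw [hb i hi, bdist_boundary ⟨j⟩ hi]
  obtain ⟨k, hk, hneg⟩ : ∃ k ∈ N.Inc i, vertexFlux N Q i k < 0 := by
    have hs := hQ.kirchhoff i hi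
    by_contra! hcon
    exact h ((Finset.sum_eq_zero_iff_of_nonneg hcon).1 hs j hj)
  have harc := hη.strictMono_arc k (N.len_pos k)
  rw [arc_zero] at harc
  have hle : u (N.pos i) ≤ N.bdist η (N.pos i) := by
    rw [← N.param_endParam hk]
    exact hlip.le_bdist hη hb (N.endParam_mem i k)
  refine le_antisymm hle ?_
  have hanti := hQ.anti k (N.zero_mem k) (N.len_mem k) (N.len_pos k).le
  rcases N.mem_Inc.1 hk with rfl | rfl
  · rw [vertexFlux_src] at hneg
    have e := hQ.down k 0 (N.zero_mem k) hneg
    rw [arc_zero, sub_zero, N.param_zero] at e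
    have h1 := ih (N.tgt k) (show u _ < u _ by linarith) (N.tgt_mem_Inc k)
      (by rw [vertexFlux_tgt]; linarith)
    have h2 := hp.edgeLipschitz k 0 (N.zero_mem k) _ (N.len_mem k)
    rw [N.param_zero, N.param_len, arc_zero, sub_zero, abs_of_pos harc] at h2
    linarith
  · rw [vertexFlux_tgt] at hneg
    have e := hQ.up k _ (N.len_mem k) (by linarith)
    rw [N.param_len] at e
    have h1 := ih (N.src k) (show u _ < u _ by linarith) (N.src_mem_Inc k)
      (by rw [vertexFlux_src]; linarith)
    have h2 := hp.edgeLipschitz k _ (N.len_mem k) 0 (N.zero_mem k)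
    rw [N.param_zero, N.param_len, arc_zero, zero_sub, abs_neg, abs_of_pos harc] at h2
    linarith

/-- Where the flux is positive, the standing layer is the distance, growing from the source end. -/
theorem up_bdist (hη : N.IsCapacity η) (hp : N.IsPeak η p) (hlip : N.EdgeLipschitz η u)
    (hb : ∀ i ∈ N.boundary, u (N.pos i) = 0) (hQ : N.IsFlux η f u v Q) {j : Fin nE} {t : ℝ}
    (ht : t ∈ Icc 0 (N.len j)) (h : 0 < Q j t) :
    u (N.param j t) = N.bdist η (N.param j t) ∧
      N.bdist η (N.param j t) = N.bdist η (N.param j 0) + N.arc η j t := by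
  have h0 := h.trans_le (hQ.anti j (N.zero_mem j) ht ht.1)
  have h1 := eq_bdist_vertex hη hp hlip hb hQ (N.src_mem_Inc j)
    (by rw [vertexFlux_src]; exact h0.ne')
  have h2 := hQ.up j t ht h
  have h3 := hlip.le_bdist hη hb ht
  have h4 := hp.edgeLipschitz j t ht 0 (N.zero_mem j)
  have := (hη.strictMono_arc j).monotone ht.1
  rw [arc_zero] at this
  rw [arc_zero, zero_sub, abs_neg, abs_of_nonneg this] at h4
  rw [N.param_zero] at h4 ⊢
  constructor <;> linarith

/-- Where the flux is negative, the standing layer is the distance, growing from the target end. -/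
theorem down_bdist (hη : N.IsCapacity η) (hp : N.IsPeak η p) (hlip : N.EdgeLipschitz η u)
    (hb : ∀ i ∈ N.boundary, u (N.pos i) = 0) (hQ : N.IsFlux η f u v Q) {j : Fin nE} {t : ℝ}
    (ht : t ∈ Icc 0 (N.len j)) (h : Q j t < 0) :
    u (N.param j t) = N.bdist η (N.param j t) ∧ N.bdist η (N.param j t) =
      N.bdist η (N.param j (N.len j)) + (N.arc η j (N.len j) - N.arc η j t) := by
  have h0 := (hQ.anti j ht (N.len_mem j) ht.2).trans_lt h
  have h1 := eq_bdist_vertex hη hp hlip hb hQ (N.tgt_mem_Inc j)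
    (by rw [vertexFlux_tgt]; exact neg_ne_zero.2 h0.ne)
  have h2 := hQ.down j t ht h
  have h3 := hlip.le_bdist hη hb ht
  have h4 := hp.edgeLipschitz j t ht _ (N.len_mem j)
  have := (hη.strictMono_arc j).monotone ht.2
  rw [abs_of_nonneg (by linarith)] at h4
  rw [N.param_len] at h4 ⊢
  constructor <;> linarith

theorem eq_bdist (hη : N.IsCapacity η) (hp : N.IsPeak η p) (hlip : N.EdgeLipschitz η u)
    (hb : ∀ i ∈ N.boundary, u (N.pos i) = 0) (hQ : N.IsFlux η f u v Q) {j : Fin nE} {t : ℝ}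
    (ht : t ∈ Icc 0 (N.len j)) (h : Q j t ≠ 0) : u (N.param j t) = N.bdist η (N.param j t) := by
  rcases lt_or_gt_of_ne h with h | h
  · exact (hQ.down_bdist hη hp hlip hb ht h).1
  · exact (hQ.up_bdist hη hp hlip hb ht h).1

theorem le_peak (hη : N.IsCapacity η) (hp : N.IsPeak η p) (hlip : N.EdgeLipschitz η u)
    (hb : ∀ i ∈ N.boundary, u (N.pos i) = 0) (hQ : N.IsFlux η f u v Q) {j : Fin nE} {t : ℝ}
    (ht : t ∈ Icc 0 (N.len j)) (h : 0 < Q j t) : t ≤ p j := by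
  by_contra! hlt
  have h1 := (hQ.up_bdist hη hp hlip hb ht h).2
  have h2 := hp.eq_of_ge hη ht hlt.le le_rfl
  have h3 := hp.eq_of_le hη (N.zero_mem j) (hp.mem j).1 le_rfl
  have h4 := hη.strictMono_arc j hlt
  rw [arc_zero] at h3
  linarith

theorem peak_le (hη : N.IsCapacity η) (hp : N.IsPeak η p) (hlip : N.EdgeLipschitz η u)
    (hb : ∀ i ∈ N.boundary, u (N.pos i) = 0) (hQ : N.IsFlux η f u v Q) {j : Fin nE} {t : ℝ}
    (ht : t ∈ Icc 0 (N.len j)) (h : Q j t < 0) : p j ≤ t := by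
  by_contra! hlt
  have h1 := (hQ.down_bdist hη hp hlip hb ht h).2
  have h2 := hp.eq_of_le hη ht hlt.le le_rfl
  have h3 := hp.eq_of_ge hη (N.len_mem j) (hp.mem j).2 le_rfl
  have h4 := hη.strictMono_arc j hlt
  linarith

theorem peak_nonpos (hη : N.IsCapacity η) (hp : N.IsPeak η p) (hlip : N.EdgeLipschitz η u)
    (hb : ∀ i ∈ N.boundary, u (N.pos i) = 0) (hQ : N.IsFlux η f u v Q) {j : Fin nE}
    (h : p j < N.len j) : Q j (p j) ≤ 0 := by
  by_contra! hpos
  have hc : ContinuousWithinAt (Q j) (Icc 0 (N.len j)) (p j) := hQ.cont j _ (hp.mem j)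
  have h1 : ∀ᶠ t in 𝓝[Ioi (p j)] (p j), 0 < Q j t ∧ t ∈ Ioo (p j) (N.len j) := by
    have hm : Ioo (p j) (N.len j) ∈ 𝓝[>] (p j) := Ioo_mem_nhdsGT h
    refine Filter.Eventually.and ?_ hm
    rw [← nhdsWithin_Ioo_eq_nhdsGT h]
    exact (hc.mono fun t ht => ⟨(hp.mem j).1.trans ht.1.le, ht.2.le⟩).eventually
      (lt_mem_nhds hpos)
  obtain ⟨t, ht, htm⟩ := h1.exists
  exact absurd (hQ.le_peak hη hp hlip hb ⟨(hp.mem j).1.trans htm.1.le, htm.2.le⟩ ht) htm.1.not_ge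

theorem peak_nonneg (hη : N.IsCapacity η) (hp : N.IsPeak η p) (hlip : N.EdgeLipschitz η u)
    (hb : ∀ i ∈ N.boundary, u (N.pos i) = 0) (hQ : N.IsFlux η f u v Q) {j : Fin nE}
    (h : 0 < p j) : 0 ≤ Q j (p j) := by
  by_contra! hneg
  have hc : ContinuousWithinAt (Q j) (Icc 0 (N.len j)) (p j) := hQ.cont j _ (hp.mem j)
  have h1 : ∀ᶠ t in 𝓝[Iio (p j)] (p j), Q j t < 0 ∧ t ∈ Ioo 0 (p j) := by
    have hm : Ioo 0 (p j) ∈ 𝓝[<] (p j) := Ioo_mem_nhdsLT h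
    refine Filter.Eventually.and ?_ hm
    rw [← nhdsWithin_Ioo_eq_nhdsLT h]
    exact (hc.mono fun t ht => ⟨ht.1.le, ht.2.le.trans (hp.mem j).2⟩).eventually
      (gt_mem_nhds hneg)
  obtain ⟨t, ht, htm⟩ := h1.exists
  exact absurd (hQ.peak_le hη hp hlip hb ⟨htm.1.le, htm.2.le.trans (hp.mem j).2⟩ ht) htm.2.not_ge

theorem v_eq_integral_add (hη : N.IsCapacity η) (hf : N.IsSource f) (hp : N.IsPeak η p)
    (hlip : N.EdgeLipschitz η u) (hb : ∀ i ∈ N.boundary, u (N.pos i) = 0)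
    (hQ : N.IsFlux η f u v Q) {j : Fin nE} {t : ℝ} (ht : t ∈ Icc 0 (N.len j)) :
    v j t = (if t ≤ p j then ∫ r in t..p j, f j r else ∫ r in p j..t, f j r) + v j (p j) := by
  rw [hQ.abs_eq j t ht, hQ.abs_eq j _ (hp.mem j)]
  rcases lt_trichotomy t (p j) with h | h | h
  · have h1 := hQ.peak_nonneg hη hp hlip hb (ht.1.trans_lt h)
    have h2 := hQ.sub_eq j t ht _ (hp.mem j)
    have h3 := hf.integral_nonneg ht (hp.mem j) h.le
    rw [if_pos h.le, abs_of_nonneg h1, abs_of_nonneg (by linarith)]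
    linarith
  · subst h; simp
  · have h1 := hQ.peak_nonpos hη hp hlip hb (h.trans_le ht.2)
    have h2 := hQ.sub_eq j _ (hp.mem j) t ht
    have h3 := hf.integral_nonneg (hp.mem j) ht h.le
    rw [if_neg h.not_ge, abs_of_nonpos h1, abs_of_nonpos (by linarith)]
    linarith

/-! ### The transmission conditions -/

theorem mem_IncPlus_bdist (hη : N.IsCapacity η) (hp : N.IsPeak η p) (hlip : N.EdgeLipschitz η u)
    (hb : ∀ i ∈ N.boundary, u (N.pos i) = 0) (hQ : N.IsFlux η f u v Q) {i : Fin nV} {j : Fin nE}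
    (hj : j ∈ N.Inc i) (h : 0 < vertexFlux N Q i j) : j ∈ N.IncPlus (N.bdist η) i := by
  refine hp.mem_IncPlus_of_ne hη hj fun he => ?_
  rcases N.mem_Inc.1 hj with rfl | rfl
  · rw [vertexFlux_src] at h
    rw [endParam_src] at he
    have := hQ.peak_nonpos hη hp hlip hb (by rw [he]; exact N.len_pos j)
    rw [he] at this
    linarith
  · rw [vertexFlux_tgt] at h
    rw [endParam_tgt] at he
    have := hQ.peak_nonneg hη hp hlip hb (by rw [he]; exact N.len_pos j)
    rw [he] at this
    linarith

theorem mem_IncMinus_bdist (hη : N.IsCapacity η) (hp : N.IsPeak η p) (hlip : N.EdgeLipschitz η u)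
    (hb : ∀ i ∈ N.boundary, u (N.pos i) = 0) (hQ : N.IsFlux η f u v Q) {i : Fin nV} {j : Fin nE}
    (hj : j ∈ N.Inc i) (h : vertexFlux N Q i j < 0) : j ∈ N.IncMinus (N.bdist η) i := by
  refine hp.mem_IncMinus_of_eq hη hj ?_
  rcases N.mem_Inc.1 hj with rfl | rfl
  · rw [vertexFlux_src] at h
    rw [endParam_src]
    exact le_antisymm (hQ.peak_le hη hp hlip hb (N.zero_mem j) h) (hp.mem j).1
  · rw [vertexFlux_tgt] at h
    rw [endParam_tgt]
    exact le_antisymm (hp.mem j).2 (hQ.le_peak hη hp hlip hb (N.len_mem j) (by linarith))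

theorem mem_IncPlus (hη : N.IsCapacity η) (hQ : N.IsFlux η f u v Q) {i : Fin nV} {j : Fin nE}
    (hj : j ∈ N.Inc i) (h : 0 < vertexFlux N Q i j) : j ∈ N.IncPlus u i := by
  have hm := (hη.strictMono_arc j).monotone
  rcases N.mem_Inc.1 hj with rfl | rfl
  · rw [vertexFlux_src] at h
    have hev := (hQ.cont j 0 (N.zero_mem j)).eventually (lt_mem_nhds h)
    rw [eventually_nhdsWithin_iff] at hev
    refine mem_IncPlus_of_eventually hη hj (by rw [endParam_src]; exact hev) fun t ht htW => ?_
    rw [endParam_src, arc_zero, sub_zero, abs_of_nonneg (by simpa [arc_zero] using hm ht.1)]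
    exact hQ.up j t ht (htW ht)
  · rw [vertexFlux_tgt] at h
    have hev := (hQ.cont j _ (N.len_mem j)).eventually (gt_mem_nhds (neg_pos.1 h))
    rw [eventually_nhdsWithin_iff] at hev
    refine mem_IncPlus_of_eventually hη hj (by rw [endParam_tgt]; exact hev) fun t ht htW => ?_
    rw [endParam_tgt, abs_sub_comm, abs_of_nonneg (by linarith [hm ht.2])]
    exact hQ.down j t ht (htW ht)

theorem mem_IncMinus (hη : N.IsCapacity η) (hQ : N.IsFlux η f u v Q) {i : Fin nV} {j : Fin nE}
    (hj : j ∈ N.Inc i) (h : vertexFlux N Q i j < 0) : j ∈ N.IncMinus u i := by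
  have hm := (hη.strictMono_arc j).monotone
  refine mem_IncMinus_of_eventually hη hj univ_mem fun t ht _ => ?_
  rcases N.mem_Inc.1 hj with rfl | rfl
  · rw [vertexFlux_src] at h
    have h1 := hQ.down j t ht ((hQ.anti j (N.zero_mem j) ht ht.1).trans_lt h)
    have h2 := hQ.down j 0 (N.zero_mem j) h
    have h3 := hm ht.1
    rw [arc_zero] at h3
    rw [N.param_zero, arc_zero] at h2
    rw [endParam_src, arc_zero, sub_zero, abs_of_nonneg h3]
    linarith
  · rw [vertexFlux_tgt] at h
    have h1 := hQ.up j t ht ((neg_lt_zero.1 h).trans_le (hQ.anti j ht (N.len_mem j) ht.2))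
    have h2 := hQ.up j _ (N.len_mem j) (neg_lt_zero.1 h)
    rw [N.param_len] at h2
    rw [endParam_tgt, abs_sub_comm, abs_of_nonneg (by linarith [hm ht.2])]
    linarith

theorem mem_IncMinus_of_mem_IncMinus_bdist (hη : N.IsCapacity η) (hp : N.IsPeak η p)
    (hlip : N.EdgeLipschitz η u) (hb : ∀ i ∈ N.boundary, u (N.pos i) = 0) {i : Fin nV} {j : Fin nE}
    (hi : u (N.pos i) = N.bdist η (N.pos i)) (h : j ∈ N.IncMinus (N.bdist η) i) :
    j ∈ N.IncMinus u i := by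
  obtain ⟨hj, hpe⟩ := (hp.mem_IncMinus_iff hη).1 h
  refine mem_IncMinus_of_eventually hη hj univ_mem fun t ht _ => ?_
  have h1 := hp.eq j t ht
  have h2 := hlip.le_bdist hη hb ht
  have h3 := hlip j _ (N.endParam_mem i j) t ht
  rw [hpe, abs_sub_comm, N.param_endParam hj] at h1
  rw [N.param_endParam hj] at h3
  linarith

theorem sum_IncPlus_eq (hQ : N.IsFlux η f u v Q) {g : EuclideanSpace ℝ (Fin n) → ℝ} {i : Fin nV}
    (h1 : ∀ j ∈ N.Inc i, 0 < vertexFlux N Q i j → j ∈ N.IncPlus g i)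
    (h2 : ∀ j ∈ N.Inc i, vertexFlux N Q i j < 0 → j ∈ N.IncMinus g i) :
    ∑ k ∈ N.IncPlus g i, v k (N.endParam i k) =
      ∑ k ∈ (N.Inc i).filter (fun k => 0 < vertexFlux N Q i k), v k (N.endParam i k) := by
  symm
  apply Finset.sum_subset
  · intro k hk
    rw [Finset.mem_filter] at hk
    exact h1 k hk.1 hk.2
  · intro k hk hk'
    have hki := (Network.mem_IncPlus.1 hk).1
    rw [Finset.mem_filter, not_and] at hk'
    rw [hQ.abs_vertexFlux, abs_eq_zero]
    rcases lt_trichotomy (vertexFlux N Q i k) 0 with h | h | h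
    · exact (notMem_IncMinus_of_mem_IncPlus hk (h2 k hki h)).elim
    · exact h
    · exact (hk' hki h).elim

/-- The transmission conditions hold with the slopes of the distance from the boundary. -/
theorem transmission_bdist (hη : N.IsCapacity η) (hC : N.IsDistribution C) (hp : N.IsPeak η p)
    (hlip : N.EdgeLipschitz η u) (hb : ∀ i ∈ N.boundary, u (N.pos i) = 0)
    (hQ : N.IsFlux η f u v Q) (htr : N.Transmission C u v) {i : Fin nV} {j : Fin nE}
    (hj : j ∈ N.IncMinus (N.bdist η) i) :
    v j (N.endParam i j) = C i (N.IncMinus (N.bdist η) i) j *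
      ∑ k ∈ N.IncPlus (N.bdist η) i, v k (N.endParam i k) := by
  have hi := hp.notMem_boundary hη hj
  have hji := (Network.mem_IncMinus.1 hj).1
  have hsd := hQ.sum_IncPlus_eq (g := N.bdist η) (i := i)
    (fun k hk => hQ.mem_IncPlus_bdist hη hp hlip hb hk)
    (fun k hk => hQ.mem_IncMinus_bdist hη hp hlip hb hk)
  have hsu := hQ.sum_IncPlus_eq (g := u) (i := i) (fun k hk => hQ.mem_IncPlus hη hk)
    (fun k hk => hQ.mem_IncMinus hη hk)
  have hnn : ∀ k ∈ (N.Inc i).filter (fun k => 0 < vertexFlux N Q i k),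
      0 ≤ v k (N.endParam i k) := fun k _ => hQ.v_nonneg (N.endParam_mem i k)
  rcases (Finset.sum_nonneg hnn).eq_or_lt with h0 | hpos
  · rw [hsd, ← h0, mul_zero, hQ.abs_vertexFlux, abs_eq_zero]
    by_contra hne
    obtain ⟨k, hk, hkpos⟩ : ∃ k ∈ N.Inc i, 0 < vertexFlux N Q i k := by
      have hs := hQ.kirchhoff i hi
      by_contra! hcon
      exact hne ((Finset.sum_eq_zero_iff_of_nonpos hcon).1 hs j hji)
    have := (Finset.sum_eq_zero_iff_of_nonneg hnn).1 h0.symm k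
      (Finset.mem_filter.2 ⟨hk, hkpos⟩)
    rw [hQ.abs_vertexFlux, abs_eq_zero] at this
    exact hkpos.ne' this
  · obtain ⟨k₀, hk₀, hk₀ne⟩ := Finset.exists_ne_zero_of_sum_ne_zero hpos.ne'
    rw [Finset.mem_filter] at hk₀
    have hui := hQ.eq_bdist_vertex hη hp hlip hb hk₀.1 hk₀.2.ne'
    have heq : N.IncMinus u i = N.IncMinus (N.bdist η) i := by
      ext k
      refine ⟨fun hk => ?_, mem_IncMinus_of_mem_IncMinus_bdist hη hp hlip hb hui⟩
      have hki := (Network.mem_IncMinus.1 hk).1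
      have hvk := (htr i hi k hki).2 hk
      have hCk := (hC i hi (N.IncMinus u i) (fun l hl => (Network.mem_IncMinus.1 hl).1)
        ⟨k, hk⟩).1 k hk
      rw [hsu, hQ.abs_vertexFlux] at hvk
      have hne : vertexFlux N Q i k ≠ 0 := abs_ne_zero.1 (hvk ▸ (mul_pos hCk hpos).ne')
      rcases lt_or_gt_of_ne hne with h | h
      · exact hQ.mem_IncMinus_bdist hη hp hlip hb hki h
      · exact (notMem_IncMinus_of_mem_IncPlus (hQ.mem_IncPlus hη hki h) hk).elim
    have := (htr i hi j hji).2 (heq ▸ hj)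
    rw [this, heq, hsu, hsd]

/-- The rolling layer of a solution satisfies the representation formula. -/
theorem isRollingFormula (hη : N.IsCapacity η) (hf : N.IsSource f) (hC : N.IsDistribution C)
    (hp : N.IsPeak η p) (hlip : N.EdgeLipschitz η u) (hb : ∀ i ∈ N.boundary, u (N.pos i) = 0)
    (hQ : N.IsFlux η f u v Q) (htr : N.Transmission C u v) : N.IsRollingFormula η f C v := by
  classical
  rw [hp.isRollingFormula_iff hη]
  intro j t ht
  rw [hQ.v_eq_integral_add hη hf hp hlip hb ht]
  congr 1
  by_cases h : ∃ i, j ∈ N.IncMinus (N.bdist η) i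
  · obtain ⟨i, hi⟩ := h
    obtain ⟨hji, hpe⟩ := (hp.mem_IncMinus_iff hη).1 hi
    have hfilter : Finset.univ.filter (fun i => j ∈ N.IncMinus (N.bdist η) i) = {i} := by
      ext k
      simp only [Finset.mem_filter, Finset.mem_univ, true_and, Finset.mem_singleton]
      refine ⟨fun hk => ?_, fun hk => hk ▸ hi⟩
      obtain ⟨hjk, hpk⟩ := (hp.mem_IncMinus_iff hη).1 hk
      exact N.endParam_injective hjk hji (hpk.symm.trans hpe)
    rw [hfilter, Finset.sum_singleton, ← hQ.transmission_bdist hη hC hp hlip hb htr hi, hpe]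
  · have hint : p j ∈ Ioo 0 (N.len j) := (hp.interior_or_vertex hη j).resolve_right h
    rw [Finset.sum_eq_zero fun i hi => (h ⟨i, (Finset.mem_filter.1 hi).2⟩).elim,
      hQ.abs_eq j _ (hp.mem j), abs_eq_zero]
    exact le_antisymm (hQ.peak_nonpos hη hp hlip hb hint.2) (hQ.peak_nonneg hη hp hlip hb hint.1)

/-! ### The minimal profile -/

theorem reachesUphill_of_vertex (hη : N.IsCapacity η) (hp : N.IsPeak η p)
    (hlip : N.EdgeLipschitz η u) (hb : ∀ i ∈ N.boundary, u (N.pos i) = 0)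
    (hQ : N.IsFlux η f u v Q) {j : Fin nE} {t : ℝ} (ht : t ∈ Icc 0 (N.len j)) (h : Q j t ≠ 0)
    (hS : ∀ i, j ∈ N.IncMinus (N.bdist η) i → vertexFlux N Q i j ≠ 0 →
      N.ReachesUphill η (N.sourceSupport f) (N.pos i)) :
    N.ReachesUphill η (N.sourceSupport f) (N.param j t) := by
  by_cases hint : ∫ r in t..p j, f j r = 0
  · have hQp : Q j (p j) ≠ 0 := by
      have := hQ.sub_eq j t ht _ (hp.mem j)
      rw [hint, sub_eq_zero] at this
      rwa [← this]
    rcases hp.interior_or_vertex hη j with h' | ⟨i, hi⟩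
    · exact (hQp (le_antisymm (hQ.peak_nonpos hη hp hlip hb h'.2)
        (hQ.peak_nonneg hη hp hlip hb h'.1))).elim
    · refine hp.reachesUphill_of_vertex hη ht hi (hS i hi ?_)
      rw [((hp.mem_IncMinus_iff hη).1 hi).2] at hQp
      rw [← abs_ne_zero, ← hQ.abs_vertexFlux, hQ.abs_eq j _ (N.endParam_mem i j), abs_ne_zero]
      exact hQp
  · obtain ⟨r, hr, hre⟩ := exists_mem_essSupport ht (hp.mem j) hint
    exact hp.reachesUphill_of_edge hη ht hr (mem_iUnion.2 ⟨j, r, hre, rfl⟩)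

theorem reachesUphill_sourceSupport (hη : N.IsCapacity η) (hp : N.IsPeak η p)
    (hlip : N.EdgeLipschitz η u) (hb : ∀ i ∈ N.boundary, u (N.pos i) = 0)
    (hQ : N.IsFlux η f u v Q) {j : Fin nE} {t : ℝ} (ht : t ∈ Icc 0 (N.len j)) (h : Q j t ≠ 0) :
    N.ReachesUphill η (N.sourceSupport f) (N.param j t) := by
  have hvert : ∀ i, ∀ j, j ∈ N.IncMinus (N.bdist η) i → vertexFlux N Q i j ≠ 0 →
      N.ReachesUphill η (N.sourceSupport f) (N.pos i) := by
    let r : Fin nV → Fin nV → Prop := fun k i => N.bdist η (N.pos i) < N.bdist η (N.pos k)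
    have : IsTrans (Fin nV) r := ⟨fun _ _ _ h1 h2 => lt_trans h2 h1⟩
    have : Std.Irrefl r := ⟨fun _ h => lt_irrefl _ h⟩
    intro i
    induction i using (Finite.wellFounded_of_trans_of_irrefl r).induction with
    | _ i ih =>
    intro j hj hne
    have hi := hp.notMem_boundary hη hj
    obtain ⟨k, hk, hkpos⟩ : ∃ k ∈ N.Inc i, 0 < vertexFlux N Q i k := by
      have hs := hQ.kirchhoff i hi
      by_contra! hcon
      exact hne ((Finset.sum_eq_zero_iff_of_nonpos hcon).1 hs j (Network.mem_IncMinus.1 hj).1)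
    have hkd := hQ.mem_IncPlus_bdist hη hp hlip hb hk hkpos
    rw [← N.param_endParam hk]
    refine hQ.reachesUphill_of_vertex hη hp hlip hb (N.endParam_mem i k) ?_ fun i' hi' hne' =>
      ih i' (hp.bdist_lt_of_IncPlus_IncMinus hη hkd hi') k hi' hne'
    rw [← abs_ne_zero, ← hQ.abs_eq k _ (N.endParam_mem i k), hQ.abs_vertexFlux, abs_ne_zero]
    exact hkpos.ne'
  exact hQ.reachesUphill_of_vertex hη hp hlip hb ht h fun i hi hne => hvert i j hi hne

theorem eq_bdist_of_mem_closure (hη : N.IsCapacity η) (hp : N.IsPeak η p)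
    (hlip : N.EdgeLipschitz η u) (hb : ∀ i ∈ N.boundary, u (N.pos i) = 0)
    (hu : N.IsContinuous u) (hQ : N.IsFlux η f u v Q) {j : Fin nE} {t : ℝ}
    (h : t ∈ closure {t ∈ Icc 0 (N.len j) | v j t ≠ 0}) :
    t ∈ Icc 0 (N.len j) ∧ u (N.param j t) = N.bdist η (N.param j t) := by
  have hd : ContinuousOn (fun t => N.bdist η (N.param j t)) (Icc 0 (N.len j)) := by
    refine ContinuousOn.congr ?_ (hp.eq j)
    exact (continuous_const.sub
      (continuous_const.sub (hη.continuous_arc j)).abs).continuousOn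
  have hcl := ((hu j).sub hd).preimage_isClosed_of_isClosed isClosed_Icc
    (isClosed_singleton (x := (0 : ℝ)))
  have hmem := closure_minimal (t := Icc 0 (N.len j) ∩
    (fun t => N.proj u j t - N.bdist η (N.param j t)) ⁻¹' {0}) (fun s hs => ?_) hcl h
  · exact ⟨hmem.1, sub_eq_zero.1 hmem.2⟩
  · refine ⟨hs.1, sub_eq_zero.2 (hQ.eq_bdist hη hp hlip hb hs.1 ?_)⟩
    have := hs.2
    rw [hQ.abs_eq j s hs.1] at this
    exact abs_ne_zero.1 this

end IsFlux

end Network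

/-- There is exactly one `v^f` given by the representation formula, and every solution `(u, v)`
satisfies `u = d = u^f` on `supp(v^f)` and `v = v^f` on every closed edge; if moreover
`S(d) ⊆ supp(f)`, then `(u, v) = (d, v^f)` everywhere. -/
theorem mainTheorem2 {n nV nE : ℕ} (N : Network n nV nE) (η f : Fin nE → ℝ → ℝ)
    (C : Fin nV → Finset (Fin nE) → Fin nE → ℝ)
    (hη : N.IsCapacity η) (hf : N.IsSource f) (hC : N.IsDistribution C) :
    ∃ vf : Fin nE → ℝ → ℝ,
      N.IsRollingFormula η f C vf ∧
      (∀ w : Fin nE → ℝ → ℝ, N.IsRollingFormula η f C w →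
        ∀ j, Set.EqOn (w j) (vf j) (Set.Icc 0 (N.len j))) ∧
      ∀ (u : EuclideanSpace ℝ (Fin n) → ℝ) (v : Fin nE → ℝ → ℝ), N.IsSolution η f C u v →
        (∀ x ∈ N.rollingSupport vf, u x = N.bdist η x ∧ N.bdist η x = N.minimalProfile η f x) ∧
        (∀ j, Set.EqOn (v j) (vf j) (Set.Icc 0 (N.len j))) ∧
        (N.singularSet η ⊆ N.sourceSupport f →
          Set.EqOn u (N.bdist η) N.carrier ∧
          ∀ j, Set.EqOn (v j) (vf j) (Set.Icc 0 (N.len j))) := by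
  obtain ⟨p, hp⟩ := hη.exists_isPeak
  obtain ⟨⟨vf, hvf⟩, huniq⟩ := hp.exists_unique_rollingFormula hη f C
  refine ⟨vf, hvf, fun w hw => huniq w vf hw hvf, fun u v h => ?_⟩
  obtain ⟨hlip, Q, hQ⟩ := h.exists_isFlux hη hf
  have hb := h.dirichlet
  have hv : ∀ j, EqOn (v j) (vf j) (Icc 0 (N.len j)) :=
    huniq v vf (hQ.isRollingFormula hη hf hC hp hlip hb h.transmission) hvf
  have hcl : ∀ j t, t ∈ closure {t ∈ Icc 0 (N.len j) | v j t ≠ 0} →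
      t ∈ Icc 0 (N.len j) ∧ u (N.param j t) = N.bdist η (N.param j t) := fun j t ht =>
    hQ.eq_bdist_of_mem_closure hη hp hlip hb h.viscosity.cont ht
  refine ⟨fun x hx => ?_, hv, fun hS => ⟨?_, hv⟩⟩
  · obtain ⟨j, t, ht, rfl⟩ := mem_iUnion.1 hx
    have hset : {t ∈ Icc 0 (N.len j) | vf j t ≠ 0} = {t ∈ Icc 0 (N.len j) | v j t ≠ 0} := by
      ext s
      exact and_congr_right fun hs => by rw [hv j hs]
    rw [hset] at ht
    obtain ⟨htm, hu⟩ := hcl j t ht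
    refine ⟨hu, hp.bdist_eq_minimalProfile hη htm ?_⟩
    by_cases h0 : Q j t = 0
    · exact ⟨_, mem_iUnion.2 ⟨j, t, hQ.mem_essSupport_of_mem_closure htm ht h0, rfl⟩, 0,
        Network.isPathLength_refl htm, (add_zero _).symm⟩
    · exact hQ.reachesUphill_sourceSupport hη hp hlip hb htm h0
  · have key : ∀ j, ∀ t ∈ Icc 0 (N.len j), u (N.param j t) = N.bdist η (N.param j t) := by
      intro j t ht
      refine hlip.eq_bdist_of_reachesUphill hη hb (fun y hy => ?_) ht
        (hp.reachesUphill_singularSet hη ht)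
      obtain ⟨k, s, hs, rfl⟩ := mem_iUnion.1 (hS hy)
      exact (hcl k s (hQ.mem_closure_of_mem_essSupport hf hs)).2
    rintro x (⟨i, rfl⟩ | hx)
    · obtain ⟨j₀, -⟩ := hf.2.2
      obtain ⟨j, hj⟩ := N.exists_mem_Inc ⟨j₀⟩ i
      rw [← N.param_endParam hj]
      exact key j _ (N.endParam_mem i j)
    · obtain ⟨j, t, ht, rfl⟩ := mem_iUnion.1 hx
      exact key j t ht
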